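/- The double tetrahedron is the triangulation of $S^3$ obtained by gluing two tetrahedra with vertices $1,2,3,4$ along corresponding faces. A metric on it is a vector $\ell=(\ell_{12},\ell_{13},\ell_{14},\ell_{23},\ell_{24},\ell_{34})$ of edge lengths of a nondegenerate Euclidean tetrahedron (the generating tetrahedron; both tetrahedra of the triangulation have these lengths). The metric is equihedral if all four faces of the generating tetrahedron are congruent. Let $\beta_{ij}$ be the dihedral angle of the generating tetrahedron at the edge $ij$, and $$\mathcal{LEHR}(\ell)=\frac{\sum_{i<j}(2\pi-2\beta_{ij})\,\ell_{ij}}{\sum_{i<j}\ell_{ij}} .$$ The conformal class of $\ell$ consists of the metrics $\ell_{ij}(f)=e^{(f_i+f_j)/2}\ell_{ij}$ with $f\in\mathbb R^4$. We say that $\mathcal{LEHR}$ is convex in the conformal class at $\ell$ if the matrix $\left(\partial^2\mathcal{LEHR}(\ell(f))/\partial f_v\partial f_w\right)_{v,w}$ at $f=0$ is positive semidefinite. For a tetrahedron $t$ with circumcenter $c_t$ and a face $f$ of $t$ with circumcenter $c_f$, let $h_{f<t}$ be the signed height of $c_t$ over the plane of $f$ (positive on the side of the vertex opposite to $f$), and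 for an edge $e$ of $f$ let $h_{e<f}$ be the signed height of $c_f$ over the line of $e$ inside the plane of $f$ (positive on the side of the third vertex). The dual length of $e$ is $$\ell_e^*=\sum_{t>e}\tfrac12\left(h_{e<f}h_{f<t}+h_{e<f'}h_{f'<t}\right),$$ the sum being over the two tetrahedra $t$, with $f,f'$ the faces of $t$ containing $e$. The discrete Laplacian is the $4\times4$ matrix with entries $\Delta_{vw}=\ell^*_{vw}/\ell_{vw}$ for $v\ne w$ and $\Delta_{vv}=-\sum_{u\neq v}\ell^*_{vu}/\ell_{vu}$. **Theorem.** 1. At every equihedral metric, all faces are acute triangles, all dual lengths $\ell_e^*$ are nonnegative, and the discrete Laplacian $\Delta$ is negative semidefinite. 2. At every equihedral metric $\ell$ the function $f\mapsto\mathcal{LEHR}(\ell(f))$ is twice continuously differentiable near $f=0$. $\mathcal{LEHR}$ is convex in the conformal class at some, but not all, equihedral metrics. More precisely, the metrics $(\ell_{12},\ell_{13},\ell_{14},\ell_{23},\ell_{24},\ell_{34})=(t,1,1,1,1,t)$ with $1\le t<\sqrt2$ are equihedral, and there is a number $t_0$ with $1.31471<t_0<1.31472$ such that, for $1\le t<\sqrt2$,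 $\mathcal{LEHR}$ is convex in the conformal class at $(t,1,1,1,1,t)$ if and only if $t\le t_0$. -/

import Mathlib

namespace DoubleTetrahedron

/-- Nondegenerate Euclidean tetrahedra with vertices labelled by `Fin 4`. -/
abbrev Tetrahedron : Type := Affine.Simplex ℝ (EuclideanSpace ℝ (Fin 3)) 3

/-- The six edge lengths, recorded as a table: `ℓ i j` is the length of the edge joining the
vertices `i` and `j`.  (Tables coming from a tetrahedron are symmetric with zero diagonal.) -/
abbrev Lengths : Type := Fin 4 → Fin 4 → ℝ

/-- `T` is a Euclidean tetrahedron with edge lengths `ℓ`. -/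
def Realizes (T : Tetrahedron) (ℓ : Lengths) : Prop :=
  ∀ i j, dist (T.points i) (T.points j) = ℓ i j

/-- All four faces of `T` are congruent triangles.  The face opposite to the vertex `a` is
`T.faceOpposite a`; the permutation `σ` matches the vertices of the two triangles. -/
def EquihedralTetrahedron (T : Tetrahedron) : Prop :=
  ∀ a b : Fin 4, ∃ σ : Equiv.Perm (Fin 3),
    Congruent (T.faceOpposite a).points ((T.faceOpposite b).points ∘ σ)

/-- `ℓ` is an equihedral metric on the double tetrahedron: its generating tetrahedron exists,
is nondegenerate, and has four congruent faces. -/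
def EquihedralMetric (ℓ : Lengths) : Prop :=
  ∃ T : Tetrahedron, Realizes T ℓ ∧ EquihedralTetrahedron T

/-- The angle at `i` of the triangle `ijk`, by the law of cosines. -/
noncomputable def faceAngle (ℓ : Lengths) (i j k : Fin 4) : ℝ :=
  Real.arccos ((ℓ i j ^ 2 + ℓ i k ^ 2 - ℓ j k ^ 2) / (2 * ℓ i j * ℓ i k))

/-- The dihedral angle at the edge `ij` of the tetrahedron `ijkl`, by the spherical law of
cosines applied to the three face angles at `i`. -/
noncomputable def dihedralAngle (ℓ : Lengths) (i j k l : Fin 4) : ℝ :=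
  Real.arccos
    ((Real.cos (faceAngle ℓ i k l) - Real.cos (faceAngle ℓ i j k) * Real.cos (faceAngle ℓ i j l)) /
      (Real.sin (faceAngle ℓ i j k) * Real.sin (faceAngle ℓ i j l)))

/-- The six edges `ij`, each listed as `(i, j, k, l)` with `k, l` the two other vertices. -/
def edges : Fin 6 → Fin 4 × Fin 4 × Fin 4 × Fin 4 :=
  ![(0, 1, 2, 3), (0, 2, 1, 3), (0, 3, 1, 2), (1, 2, 0, 3), (1, 3, 0, 2), (2, 3, 0, 1)]

/-- The edge curvature at `ij`: the angle defect times the length.  Two tetrahedra, indexed by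
`Fin 2`, with the same edge lengths meet at each edge of the double tetrahedron. -/
noncomputable def edgeCurvature (ℓ : Lengths) (i j k l : Fin 4) : ℝ :=
  (2 * Real.pi - ∑ _t : Fin 2, dihedralAngle ℓ i j k l) * ℓ i j

/-- The Einstein-Hilbert-Regge functional of the double tetrahedron. -/
noncomputable def EHR (ℓ : Lengths) : ℝ :=
  ∑ e : Fin 6, edgeCurvature ℓ (edges e).1 (edges e).2.1 (edges e).2.2.1 (edges e).2.2.2

/-- The total length of the double tetrahedron. -/
def totalLength (ℓ : Lengths) : ℝ :=
  ∑ e : Fin 6, ℓ (edges e).1 (edges e).2.1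

/-- The length normalized Einstein-Hilbert-Regge functional. -/
noncomputable def LEHR (ℓ : Lengths) : ℝ := EHR ℓ / totalLength ℓ

/-- The metric with conformal factor `f` in the conformal class of `ℓ`. -/
noncomputable def conformalChange (ℓ : Lengths) (f : Fin 4 → ℝ) : Lengths :=
  fun i j => Real.exp ((f i + f j) / 2) * ℓ i j

/-- The functional `LEHR` restricted to the conformal class of `ℓ`, as a function of the
conformal factor; `f = 0` corresponds to `ℓ`. -/
noncomputable def conformalLEHR (ℓ : Lengths) (f : Fin 4 → ℝ) : ℝ :=
  LEHR (conformalChange ℓ f)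

/-- The matrix of second partial derivatives `∂²LEHR / ∂f_v ∂f_w` at `f = 0`. -/
noncomputable def conformalHessian (ℓ : Lengths) : Matrix (Fin 4) (Fin 4) ℝ :=
  Matrix.of fun v w =>
    lineDeriv ℝ (fun f => lineDeriv ℝ (conformalLEHR ℓ) f (Pi.single w 1)) 0 (Pi.single v 1)

/-- `LEHR` is convex within the conformal class at the metric `ℓ`: the Hessian in the conformal
directions is positive semidefinite. -/
def ConformallyConvexAt (ℓ : Lengths) : Prop :=
  (conformalHessian ℓ).PosSemidef

/-- The signed height of the circumcenter of the tetrahedron `T` over its face opposite to `l`,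
positive on the side of the vertex `l`. -/
noncomputable def faceHeight (T : Tetrahedron) (l : Fin 4) : ℝ :=
  T.signedInfDist l T.circumcenter

/-- For `i, j, k, l` distinct: within the face `ijk`, which is opposite to `l`, the signed height
of the circumcenter of the face over the edge `ij`, positive on the side of the vertex `k`. -/
noncomputable def edgeHeight (T : Tetrahedron) (i j k l : Fin 4) : ℝ :=
  (affineSpan ℝ {T.points i, T.points j}).signedInfDist (T.points k)
    (T.faceOpposite l).circumcenter

/-- The dual length of the edge `ij` of the double tetrahedron glued from `T 0` and `T 1`.
The inner sums run over the two faces `ijk` of a tetrahedron that contain the edge, `l` being the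
vertex opposite to the face. -/
noncomputable def dualLength (T : Fin 2 → Tetrahedron) (i j : Fin 4) : ℝ :=
  ∑ t : Fin 2, (1 / 2 : ℝ) *
    ∑ k : Fin 4 with k ≠ i ∧ k ≠ j, ∑ l : Fin 4 with l ≠ i ∧ l ≠ j ∧ l ≠ k,
      edgeHeight (T t) i j k l * faceHeight (T t) l

/-- The discrete Laplacian of the double tetrahedron with edge lengths `ℓ`, glued from `T 0` and
`T 1`. -/
noncomputable def laplacian (ℓ : Lengths) (T : Fin 2 → Tetrahedron) :
    Matrix (Fin 4) (Fin 4) ℝ :=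
  Matrix.of fun v w =>
    if v = w then - ∑ u : Fin 4 with u ≠ v, dualLength T v u / ℓ v u
    else dualLength T v w / ℓ v w

/-- The lengths `(ℓ₁₂, ℓ₁₃, ℓ₁₄, ℓ₂₃, ℓ₂₄, ℓ₃₄) = (t, 1, 1, 1, 1, t)`. -/
def family (t : ℝ) : Lengths :=
  ![![0, t, 1, 1], ![t, 0, 1, 1], ![1, 1, 0, t], ![1, 1, t, 0]]

end DoubleTetrahedron

open scoped RealInnerProductSpace
open Finset Filter Topology

namespace DoubleTetrahedron

/-! A tetrahedron with congruent faces is a disphenoid: equality of the four perimeters already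
forces opposite edges to be equal (`EquihedralTetrahedron.opposite_eq`). Reading the vertices as
elements of the Klein four-group, the length of an edge depends only on the xor of its endpoints. In
a disphenoid the segment joining the midpoints of two opposite edges is nonzero, and up to a
positive factor its squared length is the inner product of two edge vectors of a face; hence every
face is acute. The centroid is equidistant from the vertices, so it is the circumcenter and lies
inside. All signed heights, and with them all dual lengths, are therefore nonnegative, and
`-laplacian` is a graph Laplacian with nonnegative weights. For the Hessian, the second derivative
is treated as a quadratic form, `conformalForm`. It is unchanged by adding constants (scale
invariance) and by the symmetries of the metric. At lengths `(a, b, b, b, b, a)` a symmetry group of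
order 8 diagonalises it, leaving the values at `(1, 1, -1, -1)` and `(1, -1, 1, -1)`; a relabelling
turns the second into the first direction at another disphenoid. That direction scales two opposite
edges by `exp s` and `exp (-s)` and fixes the other four. Along it the Schläfli formula
(`hasDerivAt_angleSum`) gives a first derivative free of derivatives of angles, and one more
differentiation gives the closed form `IsAcute.conformalForm_eq`. On the family one of the two
values is always nonnegative, and the other has the sign of `-convexityDefect t`. This defect is
strictly increasing and changes sign between the two decimal bounds, which gives the threshold. -/

/-! ### Disphenoids and their Klein four-group symmetry -/

/-- The table of edge lengths of a disphenoid: opposite edges have equal lengths `a`, `b`, `c`. -/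
def disphenoid (a b c : ℝ) : Lengths := fun i j => ![0, a, b, c] (i ^^^ j)

theorem family_eq_disphenoid (t : ℝ) : family t = disphenoid t 1 1 := by
  funext i j
  fin_cases i <;> fin_cases j <;> rfl

theorem xor_xor_xor_cancel_left (g i j : Fin 4) : (g ^^^ i) ^^^ (g ^^^ j) = i ^^^ j := by
  revert g i j; decide

/-- The Klein four-group acts by translation on the labels and preserves lengths. Being transitive
on vertices, it carries any face to any other, which makes every disphenoid equihedral. -/
theorem disphenoid_xor (a b c : ℝ) (g i j : Fin 4) :
    disphenoid a b c (g ^^^ i) (g ^^^ j) = disphenoid a b c i j := by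
  simp only [disphenoid, xor_xor_xor_cancel_left]

theorem faceOpposite_points (T : Tetrahedron) (x : Fin 4) (i : Fin 3) :
    (T.faceOpposite x).points i = T.points (x.succAbove i) :=
  T.faceOpposite_point_eq_point_succAbove x i

theorem exists_perm_succAbove (a b : Fin 4) :
    ∃ σ : Equiv.Perm (Fin 3), ∀ i, b.succAbove (σ i) = (a ^^^ b) ^^^ (a.succAbove i) := by
  revert a b; decide

theorem Realizes.equihedralTetrahedron {T : Tetrahedron} {a b c : ℝ}
    (h : Realizes T (disphenoid a b c)) : EquihedralTetrahedron T := by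
  intro x y
  obtain ⟨σ, hσ⟩ := exists_perm_succAbove x y
  refine ⟨σ, congruent_iff_dist_eq.2 fun (i j : Fin 3) => ?_⟩
  simp only [Function.comp, faceOpposite_points]
  rw [h, h, hσ, hσ, disphenoid_xor]

theorem EquihedralTetrahedron.perimeter_eq {T : Tetrahedron} (h : EquihedralTetrahedron T)
    (x y : Fin 4) :
    ∑ i, ∑ j, dist (T.points (x.succAbove i)) (T.points (x.succAbove j)) =
      ∑ i, ∑ j, dist (T.points (y.succAbove i)) (T.points (y.succAbove j)) := by
  obtain ⟨σ, hσ⟩ := h x y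
  rw [congruent_iff_dist_eq] at hσ
  rw [← Equiv.sum_comp σ (fun i => ∑ j, dist (T.points (y.succAbove i))
    (T.points (y.succAbove j)))]
  refine Finset.sum_congr rfl fun i _ => ?_
  rw [← Equiv.sum_comp σ (fun j => dist (T.points (y.succAbove (σ i)))
    (T.points (y.succAbove j)))]
  exact Finset.sum_congr rfl fun j _ => by
    simpa only [← faceOpposite_points, Function.comp_apply] using hσ i j

/-- Only the perimeters of the faces matter. Adding those of two faces and equating with the sum
over the other two, four edges cancel and twice one edge equals twice its opposite. -/
theorem EquihedralTetrahedron.opposite_eq {T : Tetrahedron} (h : EquihedralTetrahedron T) :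
    dist (T.points 0) (T.points 1) = dist (T.points 2) (T.points 3) ∧
    dist (T.points 0) (T.points 2) = dist (T.points 1) (T.points 3) ∧
    dist (T.points 0) (T.points 3) = dist (T.points 1) (T.points 2) := by
  have h1 := h.perimeter_eq 0 1
  have h2 := h.perimeter_eq 0 2
  have h3 := h.perimeter_eq 0 3
  simp only [Fin.sum_univ_three,
    dist_self, show (0 : Fin 4).succAbove (0 : Fin 3) = 1 from rfl,
    show (0 : Fin 4).succAbove (1 : Fin 3) = 2 from rfl,
    show (0 : Fin 4).succAbove (2 : Fin 3) = 3 from rfl,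
    show (1 : Fin 4).succAbove (0 : Fin 3) = 0 from rfl,
    show (1 : Fin 4).succAbove (1 : Fin 3) = 2 from rfl,
    show (1 : Fin 4).succAbove (2 : Fin 3) = 3 from rfl,
    show (2 : Fin 4).succAbove (0 : Fin 3) = 0 from rfl,
    show (2 : Fin 4).succAbove (1 : Fin 3) = 1 from rfl,
    show (2 : Fin 4).succAbove (2 : Fin 3) = 3 from rfl,
    show (3 : Fin 4).succAbove (0 : Fin 3) = 0 from rfl,
    show (3 : Fin 4).succAbove (1 : Fin 3) = 1 from rfl,
    show (3 : Fin 4).succAbove (2 : Fin 3) = 2 from rfl] at h1 h2 h3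
  simp only [dist_comm (T.points 3), dist_comm (T.points 2) (T.points 1),
    dist_comm (T.points 2) (T.points 0), dist_comm (T.points 1) (T.points 0)] at h1 h2 h3 ⊢
  refine ⟨?_, ?_, ?_⟩ <;> linarith [dist_comm (T.points 2) (T.points 3)]

/-! ### Acuteness of the faces -/

/-- The vector `p 1 + p 2 - p 0 - p 3` is twice the segment between the midpoints of two opposite
edges. Equality of opposite edges makes its squared norm four times the inner product in question.
-/
theorem inner_pos_of_opposite_dist_eq {V : Type*} [NormedAddCommGroup V] [InnerProductSpace ℝ V]
    {p : Fin 4 → V} (hp : AffineIndependent ℝ p)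
    (h1 : dist (p 0) (p 1) = dist (p 2) (p 3)) (h2 : dist (p 0) (p 2) = dist (p 1) (p 3))
    (h3 : dist (p 0) (p 3) = dist (p 1) (p 2)) : 0 < ⟪p 1 - p 0, p 2 - p 0⟫ := by
  -- Otherwise the weights `-1, 1, 1, -1`, of sum zero, would be an affine dependence.
  have hne : p 1 + p 2 - p 0 - p 3 ≠ 0 := by
    intro h0
    have := (affineIndependent_iff (k := ℝ)).1 hp Finset.univ ![-1, 1, 1, -1]
      (by simp [Fin.sum_univ_four]) (by
        simp [Fin.sum_univ_four]
        rw [← h0]; abel) 0 (Finset.mem_univ _)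
    norm_num at this
  have key : ‖p 1 + p 2 - p 0 - p 3‖ ^ 2 = 4 * ⟪p 1 - p 0, p 2 - p 0⟫ := by
    have e1 := congrArg (· ^ 2) h1
    have e2 := congrArg (· ^ 2) h2
    have e3 := congrArg (· ^ 2) h3
    simp only [dist_eq_norm, ← real_inner_self_eq_norm_sq, inner_sub_left, inner_sub_right,
      inner_add_left, inner_add_right] at e1 e2 e3 ⊢
    simp only [real_inner_comm (p 0), real_inner_comm (p 1) (p 2), real_inner_comm (p 1) (p 3),
      real_inner_comm (p 2) (p 3)] at e1 e2 e3 ⊢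
    linarith [real_inner_comm (p 0) (p 1), real_inner_comm (p 0) (p 2),
      real_inner_comm (p 0) (p 3), real_inner_comm (p 1) (p 2),
      real_inner_comm (p 1) (p 3), real_inner_comm (p 2) (p 3)]
  have : 0 < ‖p 1 + p 2 - p 0 - p 3‖ ^ 2 := by positivity
  linarith

theorem exists_fourth_vertex : ∀ i j k : Fin 4, i ≠ j → i ≠ k → j ≠ k →
    ∃ l, Function.Injective ![i, j, k, l] ∧ (i ^^^ j = k ^^^ l) ∧ (i ^^^ k = j ^^^ l) ∧
      (i ^^^ l = j ^^^ k) := by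
  decide

theorem Realizes.inner_pos {T : Tetrahedron} {a b c : ℝ}
    (h : Realizes T (disphenoid a b c)) {i j k : Fin 4} (hij : i ≠ j) (hik : i ≠ k)
    (hjk : j ≠ k) : 0 < ⟪T.points j - T.points i, T.points k - T.points i⟫ := by
  obtain ⟨l, hl, h1, h2, h3⟩ := exists_fourth_vertex i j k hij hik hjk
  have := inner_pos_of_opposite_dist_eq (p := T.points ∘ ![i, j, k, l])
    (T.independent.comp_embedding ⟨_, hl⟩)
  simp only [Function.comp, h _ _] at this
  exact this (congrArg ![0, a, b, c] h1) (congrArg ![0, a, b, c] h2) (congrArg ![0, a, b, c] h3)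

theorem Realizes.pos {T : Tetrahedron} {ℓ : Lengths} (h : Realizes T ℓ) {i j : Fin 4}
    (hij : i ≠ j) : 0 < ℓ i j := by
  rw [← h i j, dist_pos]
  exact T.independent.injective.ne hij

theorem Realizes.eq_disphenoid {T : Tetrahedron} {ℓ : Lengths} (h : Realizes T ℓ)
    (hT : EquihedralTetrahedron T) : ℓ = disphenoid (ℓ 0 1) (ℓ 0 2) (ℓ 0 3) := by
  obtain ⟨h1, h2, h3⟩ := hT.opposite_eq
  funext i j
  simp only [← h _ _]
  fin_cases i <;> fin_cases j <;>
    first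
    | exact dist_self _
    | rfl
    | exact h1.symm | exact h2.symm | exact h3.symm
    | exact dist_comm _ _
    | exact (dist_comm _ _).trans h1.symm
    | exact (dist_comm _ _).trans h2.symm
    | exact (dist_comm _ _).trans h3.symm

theorem Realizes.sq_add_sq_sub_sq_pos {T : Tetrahedron} {a b c : ℝ}
    (h : Realizes T (disphenoid a b c)) {i j k : Fin 4} (hij : i ≠ j) (hik : i ≠ k)
    (hjk : j ≠ k) :
    0 < disphenoid a b c i j ^ 2 + disphenoid a b c i k ^ 2 - disphenoid a b c j k ^ 2 := by
  have := h.inner_pos hij hik hjk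
  rw [← h, ← h, ← h, dist_eq_norm', dist_eq_norm', dist_eq_norm]
  have e : T.points j - T.points k =
    (T.points j - T.points i) - (T.points k - T.points i) := by abel
  rw [e, norm_sub_sq_real (T.points j - T.points i)]
  linarith

/-- The side lengths of an acute triangle. -/
structure IsAcute (a b c : ℝ) : Prop where
  pos₁ : 0 < a
  pos₂ : 0 < b
  pos₃ : 0 < c
  acute₁ : 0 < b ^ 2 + c ^ 2 - a ^ 2
  acute₂ : 0 < a ^ 2 + c ^ 2 - b ^ 2
  acute₃ : 0 < a ^ 2 + b ^ 2 - c ^ 2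

theorem EquihedralMetric.exists_disphenoid {ℓ : Lengths} (h : EquihedralMetric ℓ) :
    ∃ a b c, IsAcute a b c ∧ ℓ = disphenoid a b c := by
  obtain ⟨T, hT, hE⟩ := h
  have e := hT.eq_disphenoid hE
  have hT' : Realizes T (disphenoid (ℓ 0 1) (ℓ 0 2) (ℓ 0 3)) := e ▸ hT
  refine ⟨_, _, _, ⟨hT.pos (by decide), hT.pos (by decide), hT.pos (by decide), ?_, ?_, ?_⟩, e⟩
  · exact hT'.sq_add_sq_sub_sq_pos (i := 3) (j := 1) (k := 0) (by decide) (by decide) (by decide)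
  · exact hT'.sq_add_sq_sub_sq_pos (i := 1) (j := 0) (k := 2) (by decide) (by decide) (by decide)
  · exact hT'.sq_add_sq_sub_sq_pos (i := 0) (j := 1) (k := 2) (by decide) (by decide) (by decide)

theorem Realizes.faceOpposite_acuteAngled {T : Tetrahedron} {a b c : ℝ}
    (h : Realizes T (disphenoid a b c)) (x : Fin 4) : (T.faceOpposite x).AcuteAngled := by
  intro (i : Fin 3) (j : Fin 3) (k : Fin 3) hij hik hjk
  simp only [faceOpposite_points]
  rw [EuclideanGeometry.angle, InnerProductGeometry.angle, Real.arccos_lt_pi_div_two]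
  have inj := x.succAboveEmb.injective
  have hpos := fun {y z : Fin 3} (hyz : y ≠ z) =>
    norm_pos_iff.2 (sub_ne_zero.2 (T.independent.injective.ne (inj.ne hyz)))
  exact div_pos (h.inner_pos (inj.ne hij.symm) (inj.ne hjk) (inj.ne hik))
    (mul_pos (hpos hij) (hpos hjk.symm))

/-! ### Circumcenter, dual lengths and the Laplacian -/

/-- Up to the factor 4, this is the distance from a vertex to the centroid. The right side is the
same at every vertex of a disphenoid, so the centroid is the circumcenter. -/
theorem norm_four_smul_sub_sq {V : Type*} [NormedAddCommGroup V] [InnerProductSpace ℝ V]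
    {p q r s : V} (h1 : dist p q = dist r s) (h2 : dist p r = dist q s)
    (h3 : dist p s = dist q r) :
    ‖(4 : ℝ) • p - (p + q + r + s)‖ ^ 2 =
      2 * (dist p q ^ 2 + dist p r ^ 2 + dist p s ^ 2) := by
  have e1 := congrArg (· ^ 2) h1
  have e2 := congrArg (· ^ 2) h2
  have e3 := congrArg (· ^ 2) h3
  simp only [dist_eq_norm, ← real_inner_self_eq_norm_sq, inner_sub_left, inner_sub_right,
    inner_add_left, inner_add_right, real_inner_smul_left, real_inner_smul_right] at e1 e2 e3 ⊢
  linarith [real_inner_comm p q, real_inner_comm p r, real_inner_comm p s,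
    real_inner_comm q r, real_inner_comm q s, real_inner_comm r s]

theorem Realizes.centroid_eq_circumcenter {T : Tetrahedron} {a b c : ℝ}
    (h : Realizes T (disphenoid a b c)) :
    Finset.univ.affineCombination ℝ T.points (Finset.univ.centroidWeights ℝ) =
      T.circumcenter := by
  have hw : ∑ i, (Finset.univ : Finset (Fin 4)).centroidWeights ℝ i = 1 :=
    Finset.sum_centroidWeights_eq_one_of_nonempty ℝ _ Finset.univ_nonempty
  refine T.eq_circumcenter_of_dist_eq (r := √(2 * (a ^ 2 + b ^ 2 + c ^ 2)) / 4)
    (affineCombination_mem_affineSpan hw _) fun i => ?_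
  have hd : ∀ i, T.points i - Finset.univ.affineCombination ℝ T.points
      (Finset.univ.centroidWeights ℝ) = (4⁻¹ : ℝ) • ((4 : ℝ) • T.points i -
        (T.points 0 + T.points 1 + T.points 2 + T.points 3)) := by
    intro i
    rw [Finset.affineCombination_eq_linear_combination _ _ _ hw]
    simp only [Fin.sum_univ_four, Finset.centroidWeights_apply, Finset.card_univ,
      Fintype.card_fin, Nat.cast_ofNat]
    module
  rw [dist_eq_norm, hd, norm_smul, Real.norm_of_nonneg (by norm_num), inv_mul_eq_div]
  congr 1
  rw [eq_comm, Real.sqrt_eq_iff_mul_self_eq (by positivity) (norm_nonneg _), ← sq]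
  have key : ∀ {p q r s : Fin 4}, (p ^^^ q = r ^^^ s) → (p ^^^ r = q ^^^ s) →
      (p ^^^ s = q ^^^ r) → _ := fun {p q r s} h1 h2 h3 =>
    norm_four_smul_sub_sq (p := T.points p) (q := T.points q) (r := T.points r)
      (s := T.points s) (by rw [h, h]; exact congrArg ![0, a, b, c] h1)
      (by rw [h, h]; exact congrArg ![0, a, b, c] h2)
      (by rw [h, h]; exact congrArg ![0, a, b, c] h3)
  have k0 := key (p := 0) (q := 1) (r := 2) (s := 3) (by decide) (by decide) (by decide)
  have k1 := key (p := 1) (q := 0) (r := 3) (s := 2) (by decide) (by decide) (by decide)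
  have k2 := key (p := 2) (q := 3) (r := 0) (s := 1) (by decide) (by decide) (by decide)
  have k3 := key (p := 3) (q := 2) (r := 1) (s := 0) (by decide) (by decide) (by decide)
  rw [h, h, h] at k0 k1 k2 k3
  fin_cases i
  · exact k0.symm
  · rw [show T.points 0 + T.points 1 + T.points 2 + T.points 3 =
      T.points 1 + T.points 0 + T.points 3 + T.points 2 by abel]
    exact k1.symm
  · rw [show T.points 0 + T.points 1 + T.points 2 + T.points 3 =
      T.points 2 + T.points 3 + T.points 0 + T.points 1 by abel]
    exact k2.symm
  · rw [show T.points 0 + T.points 1 + T.points 2 + T.points 3 =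
      T.points 3 + T.points 2 + T.points 1 + T.points 0 by abel]
    exact k3.symm

theorem Realizes.faceHeight_nonneg {T : Tetrahedron} {a b c : ℝ}
    (h : Realizes T (disphenoid a b c)) (x : Fin 4) : 0 ≤ faceHeight T x := by
  rw [faceHeight, ← h.centroid_eq_circumcenter,
    T.signedInfDist_affineCombination x
      (Finset.sum_centroidWeights_eq_one_of_nonempty ℝ _ Finset.univ_nonempty)]
  refine mul_nonneg ?_ (norm_nonneg _)
  simp [Finset.centroidWeights_apply]

/-- Measure from the midpoint `m` of `p q`. The normal at the line towards `r` differs from `r - m`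
by a multiple of `p - q`, which is orthogonal to `x - m`; and `2⟪r - m, x - m⟫ = ⟪p - r, q - r⟫`. So
the circumcenter lies on the side of `r` when the angle at `r` is not obtuse. -/
theorem signedInfDist_affineSpan_pair_nonneg {V : Type*} [NormedAddCommGroup V]
    [InnerProductSpace ℝ V] {p q r x : V} (hxp : dist p x = dist q x) (hxr : dist r x = dist q x)
    (h : 0 ≤ ⟪p - r, q - r⟫) : 0 ≤ (affineSpan ℝ {p, q}).signedInfDist r x := by
  have hm : midpoint ℝ p q ∈ affineSpan ℝ {p, q} :=
    AffineMap.lineMap_mem_affineSpan_pair _ _ _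
  rw [AffineSubspace.signedInfDist_eq_signedDist_of_mem hm, signedDist_apply_apply,
    NormedSpace.normalize, real_inner_smul_left]
  refine mul_nonneg (by positivity) ?_
  have hproj : (EuclideanGeometry.orthogonalProjection (affineSpan ℝ {p, q}) r : V) -
      midpoint ℝ p q ∈ vectorSpan ℝ {p, q} :=
    direction_affineSpan ℝ {p, q} ▸ AffineSubspace.vsub_mem_direction (SetLike.coe_mem _) hm
  obtain ⟨c, hc⟩ := mem_vectorSpan_pair.1 hproj
  have e : r -ᵥ (EuclideanGeometry.orthogonalProjection (affineSpan ℝ {p, q}) r : V) =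
      (r - midpoint ℝ p q) - c • (p - q) := by
    rw [vsub_eq_sub] at hc ⊢
    rw [hc]; abel
  have e1 := congrArg (· ^ 2) hxp
  have e2 := congrArg (· ^ 2) hxr
  rw [e, midpoint_eq_smul_add, vsub_eq_sub, inner_sub_left (r - _), real_inner_smul_left]
  have h0 : ⟪p - q, x - (⅟2 : ℝ) • (p + q)⟫ = 0 := by
    simp only [dist_eq_norm, ← real_inner_self_eq_norm_sq, inner_sub_left, inner_sub_right,
      inner_add_right, real_inner_smul_right, invOf_eq_inv] at e1 e2 ⊢
    linarith [real_inner_comm p q, real_inner_comm p x, real_inner_comm q x]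
  have h1 : 2 * ⟪r - (⅟2 : ℝ) • (p + q), x - (⅟2 : ℝ) • (p + q)⟫ = ⟪p - r, q - r⟫ := by
    simp only [dist_eq_norm, ← real_inner_self_eq_norm_sq, inner_sub_left, inner_sub_right,
      inner_add_left, inner_add_right, real_inner_smul_left, real_inner_smul_right,
      invOf_eq_inv] at e1 e2 ⊢
    linarith [real_inner_comm p q, real_inner_comm p x, real_inner_comm q x,
      real_inner_comm r x, real_inner_comm p r, real_inner_comm q r]
  rw [h0]
  linarith

theorem exists_succAbove_eq : ∀ i l : Fin 4, i ≠ l → ∃ x : Fin 3, l.succAbove x = i := by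
  decide

theorem Realizes.edgeHeight_nonneg {T : Tetrahedron} {a b c : ℝ}
    (h : Realizes T (disphenoid a b c)) {i j k l : Fin 4} (hij : i ≠ j) (hik : i ≠ k)
    (hjk : j ≠ k) (hil : i ≠ l) (hjl : j ≠ l) (hkl : k ≠ l) : 0 ≤ edgeHeight T i j k l := by
  have hd : ∀ x, x ≠ l → dist (T.points x) (T.faceOpposite l).circumcenter =
      (T.faceOpposite l).circumradius := by
    intro x hx
    obtain ⟨y, rfl⟩ := exists_succAbove_eq x l hx
    rw [← faceOpposite_points]
    exact Affine.Simplex.dist_circumcenter_eq_circumradius _ _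
  refine signedInfDist_affineSpan_pair_nonneg ?_ ?_ ?_
  · rw [hd i hil, hd j hjl]
  · rw [hd k hkl, hd j hjl]
  · exact (h.inner_pos hik.symm hjk.symm hij).le

theorem dualLength_comm (T : Fin 2 → Tetrahedron) (i j : Fin 4) :
    dualLength T i j = dualLength T j i := by
  simp only [dualLength, edgeHeight, Set.pair_comm (((T _).points i)) ((T _).points j),
    and_comm (a := _ ≠ i) (b := _ ≠ j), and_left_comm (a := _ ≠ i) (b := _ ≠ j)]

theorem dualLength_nonneg {T : Fin 2 → Tetrahedron} {a b c : ℝ}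
    (h : ∀ t, Realizes (T t) (disphenoid a b c)) {i j : Fin 4} (hij : i ≠ j) :
    0 ≤ dualLength T i j := by
  refine sum_nonneg fun t _ => mul_nonneg (by norm_num) <| sum_nonneg fun k hk =>
    sum_nonneg fun l hl => ?_
  simp only [mem_filter, mem_univ, true_and] at hk hl
  exact mul_nonneg ((h t).edgeHeight_nonneg hij hk.1.symm hk.2.symm hl.1.symm hl.2.1.symm
    hl.2.2.symm) ((h t).faceHeight_nonneg l)

/-- A weighted graph Laplacian with nonnegative weights is negative semidefinite. -/
theorem posSemidef_neg_weighted_laplacian {ι : Type*} [Fintype ι] [DecidableEq ι]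
    (w : ι → ι → ℝ) (hw : ∀ i j, i ≠ j → 0 ≤ w i j) (hs : ∀ i j, w i j = w j i) :
    (-Matrix.of fun i j => if i = j then - ∑ u with u ≠ i, w i u else w i j).PosSemidef := by
  refine Matrix.PosSemidef.of_dotProduct_mulVec_nonneg ?_ fun x => ?_
  · ext i j
    by_cases hij : i = j
    · subst hij; simp
    · simp [hij, Ne.symm hij, hs j i]
  · have row : ∀ i, ((-Matrix.of fun i j => if i = j then - ∑ u with u ≠ i, w i u else w i j).mulVec
        x) i = ∑ j with j ≠ i, w i j * (x i - x j) := by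
      intro i
      rw [Matrix.mulVec, dotProduct, ← Finset.add_sum_erase _ _ (Finset.mem_univ i),
        Finset.filter_ne' Finset.univ i]
      simp only [mul_sub]
      rw [Finset.sum_sub_distrib, ← Finset.sum_mul, sub_eq_add_neg, ← Finset.sum_neg_distrib]
      congr 1
      · simp [Finset.filter_ne' Finset.univ i]
      · refine Finset.sum_congr rfl fun j hj => ?_
        simp [(Finset.ne_of_mem_erase hj).symm]
    simp only [dotProduct, row, star_trivial, Finset.mul_sum]
    simp only [Finset.sum_filter]
    -- Adding the sum to its copy with the indices exchanged turns each term into `w i j * (x i - x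
    -- j) ^ 2`.
    have swap : ∑ i, ∑ j, (if j ≠ i then x i * (w i j * (x i - x j)) else 0) =
        ∑ i, ∑ j, (if j ≠ i then x j * (w i j * (x j - x i)) else 0) := by
      rw [Finset.sum_comm]
      refine Finset.sum_congr rfl fun i _ => Finset.sum_congr rfl fun j _ => ?_
      simp only [ne_comm (a := i), hs j i]
    have two : 0 ≤ ∑ i, ∑ j, (if j ≠ i then x i * (w i j * (x i - x j)) else 0) +
        ∑ i, ∑ j, (if j ≠ i then x i * (w i j * (x i - x j)) else 0) := by
      nth_rewrite 2 [swap]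
      simp only [← Finset.sum_add_distrib]
      refine Finset.sum_nonneg fun i _ => Finset.sum_nonneg fun j _ => ?_
      split_ifs with hij
      · have := mul_nonneg (hw i j (Ne.symm hij)) (sq_nonneg (x i - x j))
        linarith
      · simp
    linarith

theorem posSemidef_neg_laplacian {T : Fin 2 → Tetrahedron} {ℓ : Lengths} {a b c : ℝ}
    (hℓ : ℓ = disphenoid a b c)
    (h : ∀ t, Realizes (T t) ℓ) : (-laplacian ℓ T).PosSemidef := by
  refine posSemidef_neg_weighted_laplacian (fun i j => dualLength T i j / ℓ i j) ?_ ?_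
  · intro i j hij
    exact div_nonneg (dualLength_nonneg (hℓ ▸ h) hij) ((h 0).pos hij).le
  · intro i j
    simp only [dualLength_comm T i j, ← h 0 i j, dist_comm, ← h 0 j i]

/-- The tetrahedron is spanned by alternate corners of an `x × y × z` box, so its edges are the face
diagonals of the box. -/
theorem exists_realizes_disphenoid {a b c x y z : ℝ} (hx : 0 < x) (hy : 0 < y) (hz : 0 < z)
    (ha : 0 ≤ a) (hb : 0 ≤ b) (hc : 0 ≤ c) (hxy : a ^ 2 = x ^ 2 + y ^ 2)
    (hxz : b ^ 2 = x ^ 2 + z ^ 2) (hyz : c ^ 2 = y ^ 2 + z ^ 2) :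
    ∃ T : Tetrahedron, Realizes T (disphenoid a b c) := by
  have hind : AffineIndependent ℝ (![!₂[0, 0, 0], !₂[x, y, 0], !₂[x, 0, z], !₂[0, y, z]] :
      Fin 4 → EuclideanSpace ℝ (Fin 3)) := by
    rw [affineIndependent_iff_of_fintype]
    intro w h0 h1
    rw [Finset.weightedVSub_eq_linear_combination _ h0] at h1
    simp only [Fin.sum_univ_four] at h0 h1
    have e0 := congrArg (fun v => v 0) h1
    have e1 := congrArg (fun v => v 1) h1
    have e2 := congrArg (fun v => v 2) h1
    simp at e0 e1 e2
    have f0 : w 1 + w 2 = 0 := by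
      refine (mul_eq_zero.1 ?_).resolve_right hx.ne'
      linarith
    have f1 : w 1 + w 3 = 0 := by
      refine (mul_eq_zero.1 ?_).resolve_right hy.ne'
      linarith
    have f2 : w 2 + w 3 = 0 := by
      refine (mul_eq_zero.1 ?_).resolve_right hz.ne'
      linarith
    intro i
    fin_cases i <;> simp <;> linarith
  refine ⟨⟨_, hind⟩, ?_⟩
  intro i j
  have hd : ∀ u v : EuclideanSpace ℝ (Fin 3), ∀ d : ℝ, 0 ≤ d →
      d ^ 2 = (u 0 - v 0) ^ 2 + (u 1 - v 1) ^ 2 + (u 2 - v 2) ^ 2 → dist u v = d := by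
    intro u v d hd h
    rw [EuclideanSpace.dist_eq, Real.sqrt_eq_iff_mul_self_eq (by positivity) hd]
    simp only [Fin.sum_univ_three, Real.dist_eq, sq_abs, ← h]; ring
  fin_cases i <;> fin_cases j <;> first
    | exact dist_self _
    | (refine hd _ _ a ha ?_
       simp
       linarith)
    | (refine hd _ _ b hb ?_
       simp
       linarith)
    | (refine hd _ _ c hc ?_
       simp
       linarith)

/-! ### Algebraic formulas for the dihedral angles -/

/-- Sixteen times the squared area of the triangle `ijk`. -/
def sixteenAreaSq (ℓ : Lengths) (i j k : Fin 4) : ℝ :=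
  4 * ℓ i j ^ 2 * ℓ i k ^ 2 - (ℓ i j ^ 2 + ℓ i k ^ 2 - ℓ j k ^ 2) ^ 2

/-- The numerator of the cosine of the dihedral angle at the edge `ij`. -/
def dihedralNum (ℓ : Lengths) (i j k l : Fin 4) : ℝ :=
  2 * ℓ i j ^ 2 * (ℓ i k ^ 2 + ℓ i l ^ 2 - ℓ k l ^ 2) -
    (ℓ i j ^ 2 + ℓ i k ^ 2 - ℓ j k ^ 2) * (ℓ i j ^ 2 + ℓ i l ^ 2 - ℓ j l ^ 2)

/-- The lengths satisfy the strict inequalities of the edge lengths of a tetrahedron. -/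
structure Nondegenerate (ℓ : Lengths) : Prop where
  symm : ∀ i j, ℓ i j = ℓ j i
  pos : ∀ i j, i ≠ j → 0 < ℓ i j
  face : ∀ i j k, i ≠ j → i ≠ k → j ≠ k → 0 < sixteenAreaSq ℓ i j k
  dihedral : ∀ i j k l, i ≠ j → i ≠ k → j ≠ k → i ≠ l → j ≠ l → k ≠ l →
    dihedralNum ℓ i j k l ^ 2 < sixteenAreaSq ℓ i j k * sixteenAreaSq ℓ i j l

section Formula

variable {ℓ : Lengths} {i j k l : Fin 4}

theorem Nondegenerate.cos_faceAngle_sq_lt_one (h : Nondegenerate ℓ) (hij : i ≠ j) (hik : i ≠ k)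
    (hjk : j ≠ k) :
    ((ℓ i j ^ 2 + ℓ i k ^ 2 - ℓ j k ^ 2) / (2 * ℓ i j * ℓ i k)) ^ 2 < 1 := by
  have h1 := h.pos i j hij
  have h2 := h.pos i k hik
  have h3 := h.face i j k hij hik hjk
  rw [sixteenAreaSq] at h3
  rw [div_pow, div_lt_one (by positivity)]
  nlinarith

theorem Nondegenerate.cos_faceAngle (h : Nondegenerate ℓ) (hij : i ≠ j) (hik : i ≠ k)
    (hjk : j ≠ k) : Real.cos (faceAngle ℓ i j k) =
      (ℓ i j ^ 2 + ℓ i k ^ 2 - ℓ j k ^ 2) / (2 * ℓ i j * ℓ i k) := by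
  have := abs_lt.1 ((sq_lt_one_iff_abs_lt_one _).1 (h.cos_faceAngle_sq_lt_one hij hik hjk))
  exact Real.cos_arccos this.1.le this.2.le

theorem Nondegenerate.sin_faceAngle (h : Nondegenerate ℓ) (hij : i ≠ j) (hik : i ≠ k) :
    Real.sin (faceAngle ℓ i j k) = √(sixteenAreaSq ℓ i j k) / (2 * ℓ i j * ℓ i k) := by
  have h1 := h.pos i j hij
  have h2 := h.pos i k hik
  rw [faceAngle, Real.sin_arccos, ← Real.sqrt_sq (by positivity : 0 ≤ 2 * ℓ i j * ℓ i k),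
    ← Real.sqrt_div' _ (by positivity), Real.sqrt_sq (by positivity), sixteenAreaSq]
  congr 1
  field_simp
  ring

/-- The lengths in the denominators cancel, leaving a polynomial over two areas. In this form the
angle is visibly symmetric in the endpoints of its edge, although the definition reads it off at
`i`. -/
theorem Nondegenerate.spherical_law_of_cosines_eq (h : Nondegenerate ℓ) (hij : i ≠ j)
    (hik : i ≠ k) (hjk : j ≠ k) (hil : i ≠ l) (hjl : j ≠ l) (hkl : k ≠ l) :
    (Real.cos (faceAngle ℓ i k l) -
      Real.cos (faceAngle ℓ i j k) * Real.cos (faceAngle ℓ i j l)) /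
      (Real.sin (faceAngle ℓ i j k) * Real.sin (faceAngle ℓ i j l)) =
    dihedralNum ℓ i j k l / (√(sixteenAreaSq ℓ i j k) * √(sixteenAreaSq ℓ i j l)) := by
  have h1 := h.pos i j hij
  have h2 := h.pos i k hik
  have h3 := h.pos i l hil
  have h4 := Real.sqrt_pos.2 (h.face i j k hij hik hjk)
  have h5 := Real.sqrt_pos.2 (h.face i j l hij hil hjl)
  rw [h.cos_faceAngle hik hil hkl, h.cos_faceAngle hij hik hjk,
    h.cos_faceAngle hij hil hjl, h.sin_faceAngle hij hik, h.sin_faceAngle hij hil, dihedralNum]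
  field_simp

theorem Nondegenerate.dihedralAngle_eq (h : Nondegenerate ℓ) (hij : i ≠ j) (hik : i ≠ k)
    (hjk : j ≠ k) (hil : i ≠ l) (hjl : j ≠ l) (hkl : k ≠ l) :
    dihedralAngle ℓ i j k l = Real.arccos (dihedralNum ℓ i j k l /
      (√(sixteenAreaSq ℓ i j k) * √(sixteenAreaSq ℓ i j l))) := by
  rw [dihedralAngle, h.spherical_law_of_cosines_eq hij hik hjk hil hjl hkl]

theorem Nondegenerate.dihedralAngle_comm (h : Nondegenerate ℓ) (hij : i ≠ j) (hik : i ≠ k)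
    (hjk : j ≠ k) (hil : i ≠ l) (hjl : j ≠ l) (hkl : k ≠ l) :
    dihedralAngle ℓ j i k l = dihedralAngle ℓ i j k l := by
  rw [h.dihedralAngle_eq hij hik hjk hil hjl hkl,
    h.dihedralAngle_eq hij.symm hjk hik hjl hil hkl]
  have e1 : dihedralNum ℓ j i k l = dihedralNum ℓ i j k l := by
    simp only [dihedralNum, h.symm j i]
    ring
  have e2 : ∀ m, sixteenAreaSq ℓ j i m = sixteenAreaSq ℓ i j m := fun m => by
    simp only [sixteenAreaSq, h.symm j i]
    ring
  rw [e1, e2, e2]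

theorem Nondegenerate.dihedralAngle_comm' (h : Nondegenerate ℓ) :
    dihedralAngle ℓ i j l k = dihedralAngle ℓ i j k l := by
  have e : faceAngle ℓ i l k = faceAngle ℓ i k l := by
    rw [faceAngle, faceAngle, h.symm l k, add_comm (ℓ i l ^ 2), mul_right_comm 2 (ℓ i l)]
  rw [dihedralAngle, dihedralAngle, e, mul_comm (Real.cos (faceAngle ℓ i j l)),
    mul_comm (Real.sin (faceAngle ℓ i j l))]

end Formula

theorem LEHR_eq (ℓ : Lengths) : LEHR ℓ =
    ((2 * Real.pi - 2 * dihedralAngle ℓ 0 1 2 3) * ℓ 0 1 +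
      (2 * Real.pi - 2 * dihedralAngle ℓ 0 2 1 3) * ℓ 0 2 +
      (2 * Real.pi - 2 * dihedralAngle ℓ 0 3 1 2) * ℓ 0 3 +
      (2 * Real.pi - 2 * dihedralAngle ℓ 1 2 0 3) * ℓ 1 2 +
      (2 * Real.pi - 2 * dihedralAngle ℓ 1 3 0 2) * ℓ 1 3 +
      (2 * Real.pi - 2 * dihedralAngle ℓ 2 3 0 1) * ℓ 2 3) /
    (ℓ 0 1 + ℓ 0 2 + ℓ 0 3 + ℓ 1 2 + ℓ 1 3 + ℓ 2 3) := by
  simp [LEHR, EHR, totalLength, edgeCurvature, edges, Fin.sum_univ_succ]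
  ring

/-! ### Invariance under relabelling -/

/-- Relabelling of the vertices. -/
def relabel (σ : Equiv.Perm (Fin 4)) (ℓ : Lengths) : Lengths := fun i j => ℓ (σ i) (σ j)

theorem dihedralAngle_relabel (σ : Equiv.Perm (Fin 4)) (ℓ : Lengths) (i j k l : Fin 4) :
    dihedralAngle (relabel σ ℓ) i j k l = dihedralAngle ℓ (σ i) (σ j) (σ k) (σ l) := rfl

theorem Nondegenerate.relabel {ℓ : Lengths} (h : Nondegenerate ℓ) (σ : Equiv.Perm (Fin 4)) :
    Nondegenerate (relabel σ ℓ) where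
  symm _ _ := h.symm _ _
  pos _ _ hij := h.pos _ _ (σ.injective.ne hij)
  face _ _ _ hij hik hjk :=
    h.face _ _ _ (σ.injective.ne hij) (σ.injective.ne hik) (σ.injective.ne hjk)
  dihedral _ _ _ _ hij hik hjk hil hjl hkl :=
    h.dihedral _ _ _ _ (σ.injective.ne hij) (σ.injective.ne hik) (σ.injective.ne hjk)
      (σ.injective.ne hil) (σ.injective.ne hjl) (σ.injective.ne hkl)

theorem Nondegenerate.LEHR_relabel_adjacent {ℓ : Lengths} (h : Nondegenerate ℓ) :
    LEHR (DoubleTetrahedron.relabel (Equiv.swap 0 1) ℓ) = LEHR ℓ ∧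
    LEHR (DoubleTetrahedron.relabel (Equiv.swap 1 2) ℓ) = LEHR ℓ ∧
    LEHR (DoubleTetrahedron.relabel (Equiv.swap 2 3) ℓ) = LEHR ℓ := by
  have a01 : dihedralAngle ℓ 1 0 2 3 = dihedralAngle ℓ 0 1 2 3 :=
    h.dihedralAngle_comm (by decide) (by decide) (by decide) (by decide)
      (by decide) (by decide)
  have a12 : dihedralAngle ℓ 2 1 0 3 = dihedralAngle ℓ 1 2 0 3 :=
    h.dihedralAngle_comm (by decide) (by decide) (by decide) (by decide)
      (by decide) (by decide)
  have a23 : dihedralAngle ℓ 3 2 0 1 = dihedralAngle ℓ 2 3 0 1 :=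
    h.dihedralAngle_comm (by decide) (by decide) (by decide) (by decide)
      (by decide) (by decide)
  have b0123 : dihedralAngle ℓ 0 1 3 2 = dihedralAngle ℓ 0 1 2 3 := h.dihedralAngle_comm'
  have b0312 : dihedralAngle ℓ 0 3 2 1 = dihedralAngle ℓ 0 3 1 2 := h.dihedralAngle_comm'
  have b2301 : dihedralAngle ℓ 2 3 1 0 = dihedralAngle ℓ 2 3 0 1 := h.dihedralAngle_comm'
  refine ⟨?_, ?_, ?_⟩
  · simp only [LEHR_eq, dihedralAngle_relabel]
    simp only [DoubleTetrahedron.relabel, show Equiv.swap (0 : Fin 4) 1 0 = 1 from rfl,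
      show Equiv.swap (0 : Fin 4) 1 1 = 0 from rfl, show Equiv.swap (0 : Fin 4) 1 2 = 2 from rfl,
      show Equiv.swap (0 : Fin 4) 1 3 = 3 from rfl, a01, b2301, h.symm 1 0]
    congr 1 <;> ring
  · simp only [LEHR_eq, dihedralAngle_relabel]
    simp only [DoubleTetrahedron.relabel, show Equiv.swap (1 : Fin 4) 2 0 = 0 from rfl,
      show Equiv.swap (1 : Fin 4) 2 1 = 2 from rfl, show Equiv.swap (1 : Fin 4) 2 2 = 1 from rfl,
      show Equiv.swap (1 : Fin 4) 2 3 = 3 from rfl, a12, b0312, h.symm 2 1]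
    congr 1 <;> ring
  · simp only [LEHR_eq, dihedralAngle_relabel]
    simp only [DoubleTetrahedron.relabel, show Equiv.swap (2 : Fin 4) 3 0 = 0 from rfl,
      show Equiv.swap (2 : Fin 4) 3 1 = 1 from rfl, show Equiv.swap (2 : Fin 4) 3 2 = 3 from rfl,
      show Equiv.swap (2 : Fin 4) 3 3 = 2 from rfl, a23, b0123, h.symm 3 2]
    congr 1 <;> ring

/-- `LEHR` does not depend on the labelling of the vertices. -/
theorem Nondegenerate.LEHR_relabel {ℓ : Lengths} (h : Nondegenerate ℓ)
    (σ : Equiv.Perm (Fin 4)) : LEHR (DoubleTetrahedron.relabel σ ℓ) = LEHR ℓ := by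
  -- Adjacent transpositions generate the symmetric group. The metric is generalized in the
  -- induction because a product passes through a relabelled metric.
  have hmem : σ ∈ Submonoid.closure (Set.range fun i : Fin 3 => Equiv.swap i.castSucc i.succ) := by
    rw [Equiv.Perm.mclosure_swap_castSucc_succ]; trivial
  induction hmem using Submonoid.closure_induction generalizing ℓ with
  | mem σ hσ =>
    obtain ⟨i, rfl⟩ := hσ
    obtain ⟨h0, h1, h2⟩ := h.LEHR_relabel_adjacent
    fin_cases i
    exacts [h0, h1, h2]
  | one => rfl
  | mul σ τ _ _ hσ hτ => exact (hτ (h.relabel σ)).trans (hσ h)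

/-! ### Smoothness and nondegeneracy near a disphenoid -/

theorem contDiffAt_faceAngle {ℓ : Lengths} (h : Nondegenerate ℓ) {i j k : Fin 4} (hij : i ≠ j)
    (hik : i ≠ k) (hjk : j ≠ k) : ContDiffAt ℝ 2 (fun ℓ => faceAngle ℓ i j k) ℓ := by
  have h1 := h.pos i j hij
  have h2 := h.pos i k hik
  have h3 := abs_lt.1 ((sq_lt_one_iff_abs_lt_one _).1 (h.cos_faceAngle_sq_lt_one hij hik hjk))
  refine (Real.contDiffAt_arccos h3.1.ne' h3.2.ne).comp ℓ
    (f := fun ℓ : Lengths => (ℓ i j ^ 2 + ℓ i k ^ 2 - ℓ j k ^ 2) / (2 * ℓ i j * ℓ i k)) ?_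
  refine ContDiffAt.div (by fun_prop) (by fun_prop) (by positivity)

theorem contDiffAt_dihedralAngle {ℓ : Lengths} (h : Nondegenerate ℓ) {i j k l : Fin 4}
    (hij : i ≠ j) (hik : i ≠ k) (hjk : j ≠ k) (hil : i ≠ l) (hjl : j ≠ l) (hkl : k ≠ l) :
    ContDiffAt ℝ 2 (fun ℓ => dihedralAngle ℓ i j k l) ℓ := by
  have h1 := h.pos i j hij
  have h2 := h.pos i k hik
  have h3 := h.pos i l hil
  have h4 := Real.sqrt_pos.2 (h.face i j k hij hik hjk)
  have h5 := Real.sqrt_pos.2 (h.face i j l hij hil hjl)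
  have hx : ((Real.cos (faceAngle ℓ i k l) -
      Real.cos (faceAngle ℓ i j k) * Real.cos (faceAngle ℓ i j l)) /
      (Real.sin (faceAngle ℓ i j k) * Real.sin (faceAngle ℓ i j l))) ^ 2 < 1 := by
    rw [h.spherical_law_of_cosines_eq hij hik hjk hil hjl hkl, div_pow, mul_pow,
      Real.sq_sqrt (h.face i j k hij hik hjk).le,
      Real.sq_sqrt (h.face i j l hij hil hjl).le, div_lt_one]
    · exact h.dihedral i j k l hij hik hjk hil hjl hkl
    · exact mul_pos (h.face i j k hij hik hjk) (h.face i j l hij hil hjl)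
  have hx' := abs_lt.1 ((sq_lt_one_iff_abs_lt_one _).1 hx)
  have c1 := contDiffAt_faceAngle h hik hil hkl
  have c2 := contDiffAt_faceAngle h hij hik hjk
  have c3 := contDiffAt_faceAngle h hij hil hjl
  refine (Real.contDiffAt_arccos hx'.1.ne' hx'.2.ne).comp ℓ (f := fun ℓ : Lengths =>
    (Real.cos (faceAngle ℓ i k l) -
      Real.cos (faceAngle ℓ i j k) * Real.cos (faceAngle ℓ i j l)) /
      (Real.sin (faceAngle ℓ i j k) * Real.sin (faceAngle ℓ i j l))) ?_
  refine ContDiffAt.div (c1.cos.sub (c2.cos.mul c3.cos)) (c2.sin.mul c3.sin) ?_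
  rw [h.sin_faceAngle hij hik, h.sin_faceAngle hij hil]
  positivity

theorem contDiffAt_LEHR {ℓ : Lengths} (h : Nondegenerate ℓ) : ContDiffAt ℝ 2 LEHR ℓ := by
  have e : LEHR = fun ℓ => _ := funext LEHR_eq
  rw [e]
  have c1 :=
    contDiffAt_dihedralAngle h (i := 0) (j := 1) (k := 2) (l := 3) (by decide) (by decide)
      (by decide) (by decide) (by decide) (by decide)
  have c2 :=
    contDiffAt_dihedralAngle h (i := 0) (j := 2) (k := 1) (l := 3) (by decide) (by decide)
      (by decide) (by decide) (by decide) (by decide)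
  have c3 :=
    contDiffAt_dihedralAngle h (i := 0) (j := 3) (k := 1) (l := 2) (by decide) (by decide)
      (by decide) (by decide) (by decide) (by decide)
  have c4 :=
    contDiffAt_dihedralAngle h (i := 1) (j := 2) (k := 0) (l := 3) (by decide) (by decide)
      (by decide) (by decide) (by decide) (by decide)
  have c5 :=
    contDiffAt_dihedralAngle h (i := 1) (j := 3) (k := 0) (l := 2) (by decide) (by decide)
      (by decide) (by decide) (by decide) (by decide)
  have c6 :=
    contDiffAt_dihedralAngle h (i := 2) (j := 3) (k := 0) (l := 1) (by decide) (by decide)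
      (by decide) (by decide) (by decide) (by decide)
  have p1 := h.pos 0 1 (by decide)
  have p2 := h.pos 0 2 (by decide)
  have p3 := h.pos 0 3 (by decide)
  have p4 := h.pos 1 2 (by decide)
  have p5 := h.pos 1 3 (by decide)
  have p6 := h.pos 2 3 (by decide)
  exact ContDiffAt.div (by fun_prop) (by fun_prop) (by positivity)

theorem contDiff_conformalChange (ℓ : Lengths) : ContDiff ℝ 2 (conformalChange ℓ) := by
  unfold conformalChange
  fun_prop

theorem conformalChange_zero (ℓ : Lengths) : conformalChange ℓ 0 = ℓ := by
  funext i j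
  simp [conformalChange]

theorem contDiffAt_conformalLEHR {ℓ : Lengths} (h : Nondegenerate ℓ) :
    ContDiffAt ℝ 2 (conformalLEHR ℓ) 0 :=
  ContDiffAt.comp 0 (g := LEHR) (by rw [conformalChange_zero]; exact contDiffAt_LEHR h)
    (contDiff_conformalChange ℓ).contDiffAt

/-- Nondegeneracy consists of symmetry, which conformal changes preserve, and strict inequalities,
which persist nearby by continuity or positivity. Formulas for `LEHR` thus hold on a neighbourhood
and can be differentiated. -/
theorem Nondegenerate.eventually_conformalChange {ℓ : Lengths} (h : Nondegenerate ℓ) :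
    ∀ᶠ f in nhds 0, Nondegenerate (conformalChange ℓ f) := by
  have hc : ∀ i j, Continuous fun f => conformalChange ℓ f i j := fun i j =>
    (continuous_apply_apply i j).comp (contDiff_conformalChange ℓ).continuous
  have hface : ∀ i j k, Continuous fun f => sixteenAreaSq (conformalChange ℓ f) i j k :=
    fun i j k => by unfold sixteenAreaSq; fun_prop
  have hnum : ∀ i j k l, Continuous fun f => dihedralNum (conformalChange ℓ f) i j k l :=
    fun i j k l => by unfold dihedralNum; fun_prop
  have e1 : ∀ᶠ f in nhds 0, ∀ i j k, i ≠ j → i ≠ k → j ≠ k →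
      0 < sixteenAreaSq (conformalChange ℓ f) i j k := by
    simp only [Filter.eventually_all]
    intro i j k hij hik hjk
    refine (hface i j k).continuousAt.eventually_const_lt ?_
    simp only [conformalChange_zero]
    exact h.face i j k hij hik hjk
  have e2 : ∀ᶠ f in nhds 0, ∀ i j k l, i ≠ j → i ≠ k → j ≠ k → i ≠ l → j ≠ l → k ≠ l →
      dihedralNum (conformalChange ℓ f) i j k l ^ 2 <
        sixteenAreaSq (conformalChange ℓ f) i j k * sixteenAreaSq (conformalChange ℓ f) i j l := by
    simp only [Filter.eventually_all]
    intro i j k l hij hik hjk hil hjl hkl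
    refine ContinuousAt.eventually_lt ((hnum i j k l).pow 2).continuousAt
      ((hface i j k).mul (hface i j l)).continuousAt ?_
    simp only [conformalChange_zero]
    exact h.dihedral i j k l hij hik hjk hil hjl hkl
  filter_upwards [e1, e2] with f h1 h2
  refine ⟨fun i j => ?_, fun i j hij => mul_pos (Real.exp_pos _) (h.pos i j hij), h1, h2⟩
  rw [conformalChange, conformalChange, add_comm, h.symm]

theorem xor_cases : ∀ i j k : Fin 4, i ≠ j → i ≠ k → j ≠ k →
    (i ^^^ j = 1 ∧ i ^^^ k = 2 ∧ j ^^^ k = 3) ∨ (i ^^^ j = 1 ∧ i ^^^ k = 3 ∧ j ^^^ k = 2) ∨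
    (i ^^^ j = 2 ∧ i ^^^ k = 1 ∧ j ^^^ k = 3) ∨ (i ^^^ j = 2 ∧ i ^^^ k = 3 ∧ j ^^^ k = 1) ∨
    (i ^^^ j = 3 ∧ i ^^^ k = 1 ∧ j ^^^ k = 2) ∨ (i ^^^ j = 3 ∧ i ^^^ k = 2 ∧ j ^^^ k = 1) := by
  decide

theorem xor_opposite : ∀ i j k l : Fin 4, i ≠ j ∧ i ≠ k ∧ j ≠ k ∧ i ≠ l ∧ j ≠ l ∧ k ≠ l →
    k ^^^ l = i ^^^ j ∧ j ^^^ l = i ^^^ k ∧ i ^^^ l = j ^^^ k := by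
  decide

theorem IsAcute.exists_side {a b c : ℝ} (h : IsAcute a b c) {i j k : Fin 4} (hij : i ≠ j)
    (hik : i ≠ k) (hjk : j ≠ k) :
    IsAcute (disphenoid a b c i j) (disphenoid a b c i k) (disphenoid a b c j k) := by
  obtain ⟨p1, p2, p3, h1, h2, h3⟩ := h
  simp only [disphenoid]
  rcases xor_cases i j k hij hik hjk with h | h | h | h | h | h <;>
    rw [h.1, h.2.1, h.2.2] <;> constructor <;> simp <;> linarith

/-- With `u, v, w` the three quantities assumed positive by acuteness, the expression is `u * v + u
* w + v * w`. -/
theorem IsAcute.sixteenAreaSq_pos {a b c : ℝ} (h : IsAcute a b c) :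
    0 < 4 * a ^ 2 * b ^ 2 - (a ^ 2 + b ^ 2 - c ^ 2) ^ 2 := by
  nlinarith [mul_pos h.acute₁ h.acute₂, mul_pos h.acute₁ h.acute₃, mul_pos h.acute₂ h.acute₃]

theorem IsAcute.nondegenerate {a b c : ℝ} (h : IsAcute a b c) :
    Nondegenerate (disphenoid a b c) where
  symm i j := by
    simp only [disphenoid, show i ^^^ j = j ^^^ i by revert i j; decide]
  pos i j hij := by
    obtain ⟨k, hik, hjk⟩ : ∃ k, i ≠ k ∧ j ≠ k := by revert i j; decide
    exact (h.exists_side hij hik hjk).pos₁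
  face i j k hij hik hjk := (h.exists_side hij hik hjk).sixteenAreaSq_pos
  dihedral i j k l hij hik hjk hil hjl hkl := by
    have h' := h.exists_side hij hik hjk
    obtain ⟨h1, h2, h3⟩ := xor_opposite i j k l ⟨hij, hik, hjk, hil, hjl, hkl⟩
    have e1 : disphenoid a b c k l = disphenoid a b c i j := by simp only [disphenoid, h1]
    have e2 : disphenoid a b c j l = disphenoid a b c i k := by simp only [disphenoid, h2]
    have e3 : disphenoid a b c i l = disphenoid a b c j k := by simp only [disphenoid, h3]
    simp only [dihedralNum, sixteenAreaSq, e1, e2, e3]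
    generalize disphenoid a b c i j = x at *
    generalize disphenoid a b c i k = y at *
    generalize disphenoid a b c j k = z at *
    -- The difference of the two sides is `8 * x ^ 2` times the product of the three acuteness
    -- quantities.
    have := mul_pos (mul_pos (mul_pos (pow_pos h'.pos₁ 2) h'.acute₁) h'.acute₂) h'.acute₃
    linarith

/-! ### The Hessian as a quadratic form and its symmetries -/

section SecondDerivative

variable {E : Type*} [NormedAddCommGroup E] [NormedSpace ℝ E] {φ : E → ℝ}

theorem hasFDerivAt_fderiv_of_contDiffAt_two {x : E} (h : ContDiffAt ℝ 2 φ x) :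
    HasFDerivAt (fderiv ℝ φ) (fderiv ℝ (fderiv ℝ φ) x) x :=
  ((h.fderiv_right (m := 1) (by norm_num)).differentiableAt one_ne_zero).hasFDerivAt

theorem eventually_differentiableAt_of_contDiffAt_two {x : E} (h : ContDiffAt ℝ 2 φ x) :
    ∀ᶠ y in 𝓝 x, DifferentiableAt ℝ φ y :=
  (h.eventually (by simp)).mono fun _ hy => hy.differentiableAt two_ne_zero

theorem hasLineDerivAt_fderiv_apply {x : E} (h : ContDiffAt ℝ 2 φ x) (v w : E) :
    HasLineDerivAt ℝ (fun y => fderiv ℝ φ y w) (fderiv ℝ (fderiv ℝ φ) x v w) x v := by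
  have := (hasFDerivAt_fderiv_of_contDiffAt_two h).clm_apply (hasFDerivAt_const w x)
  simpa using this.hasLineDerivAt v

theorem lineDeriv_lineDeriv_eq {x : E} (h : ContDiffAt ℝ 2 φ x) (v w : E) :
    lineDeriv ℝ (fun y => lineDeriv ℝ φ y w) x v = fderiv ℝ (fderiv ℝ φ) x v w := by
  have e : (fun y => lineDeriv ℝ φ y w) =ᶠ[𝓝 x] fun y => fderiv ℝ φ y w :=
    (eventually_differentiableAt_of_contDiffAt_two h).mono fun y hy => hy.lineDeriv_eq_fderiv
  rw [e.lineDeriv_eq]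
  exact (hasLineDerivAt_fderiv_apply h v w).lineDeriv

theorem deriv_deriv_smul_eq (h : ContDiffAt ℝ 2 φ 0) (x : E) :
    deriv (deriv fun s : ℝ => φ (s • x)) 0 = fderiv ℝ (fderiv ℝ φ) 0 x x := by
  have hs : ∀ s : ℝ, HasDerivAt (fun s : ℝ => s • x) x s := fun s => by
    simpa using (hasDerivAt_id s).smul_const x
  have ht : Tendsto (fun s : ℝ => s • x) (𝓝 0) (𝓝 0) := by
    simpa using (hs 0).continuousAt.tendsto
  have e : (deriv fun s : ℝ => φ (s • x)) =ᶠ[𝓝 0] fun s => fderiv ℝ φ (s • x) x :=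
    (ht.eventually (eventually_differentiableAt_of_contDiffAt_two h)).mono fun s hy =>
      (hy.hasFDerivAt.comp_hasDerivAt s (hs s)).deriv
  rw [e.deriv_eq]
  simpa [lineDeriv] using (hasLineDerivAt_fderiv_apply h x x).lineDeriv

end SecondDerivative

/-- The second derivative of `LEHR` at `ℓ` in the conformal direction `x`. -/
noncomputable def conformalForm (ℓ : Lengths) (x : Fin 4 → ℝ) : ℝ :=
  fderiv ℝ (fderiv ℝ (conformalLEHR ℓ)) 0 x x

theorem Nondegenerate.conformalForm_eq {ℓ : Lengths} (h : Nondegenerate ℓ) (x : Fin 4 → ℝ) :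
    conformalForm ℓ x = deriv (deriv fun s : ℝ => conformalLEHR ℓ (s • x)) 0 :=
  (deriv_deriv_smul_eq (contDiffAt_conformalLEHR h) x).symm

theorem Nondegenerate.conformalForm_congr {ℓ ℓ' : Lengths} (h : Nondegenerate ℓ)
    (h' : Nondegenerate ℓ') {x x' : Fin 4 → ℝ}
    (he : ∀ᶠ s : ℝ in 𝓝 0, conformalLEHR ℓ (s • x) = conformalLEHR ℓ' (s • x')) :
    conformalForm ℓ x = conformalForm ℓ' x' := by
  rw [h.conformalForm_eq, h'.conformalForm_eq]
  exact (EventuallyEq.deriv he).deriv_eq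

/-- The Hessian is the matrix of the second Fréchet derivative in the standard basis, and it is
symmetric because the function is `C²`. -/
theorem Nondegenerate.conformallyConvexAt_iff {ℓ : Lengths} (h : Nondegenerate ℓ) :
    ConformallyConvexAt ℓ ↔ ∀ x, 0 ≤ conformalForm ℓ x := by
  have hc := contDiffAt_conformalLEHR h
  have hsymm : IsSymmSndFDerivAt ℝ (conformalLEHR ℓ) 0 := hc.isSymmSndFDerivAt (by simp)
  have hH : ∀ v w, conformalHessian ℓ v w =
      fderiv ℝ (fderiv ℝ (conformalLEHR ℓ)) 0 (Pi.single v 1) (Pi.single w 1) := fun v w =>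
    lineDeriv_lineDeriv_eq hc _ _
  have hherm : (conformalHessian ℓ).IsHermitian := by
    ext v w
    simp only [Matrix.conjTranspose_apply, star_trivial, hH]
    exact hsymm _ _
  rw [ConformallyConvexAt, Matrix.posSemidef_iff_dotProduct_mulVec, and_iff_right hherm]
  refine forall_congr' fun x => ?_
  have e : star x ⬝ᵥ (conformalHessian ℓ).mulVec x = conformalForm ℓ x := by
    conv_rhs => rw [conformalForm, pi_eq_sum_univ' x]
    simp only [map_sum, map_smul, _root_.sum_apply, _root_.smul_apply,
      dotProduct, Matrix.mulVec, hH, star_trivial, smul_eq_mul, Finset.mul_sum]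
    rw [Finset.sum_comm]
    refine Finset.sum_congr rfl fun v _ => Finset.sum_congr rfl fun w _ => ?_
    ring
  rw [e]

theorem conformalForm_smul (ℓ : Lengths) (r : ℝ) (x : Fin 4 → ℝ) :
    conformalForm ℓ (r • x) = r ^ 2 * conformalForm ℓ x := by
  simp [conformalForm]
  ring

theorem conformalForm_neg (ℓ : Lengths) (x : Fin 4 → ℝ) :
    conformalForm ℓ (-x) = conformalForm ℓ x := by
  simp [conformalForm]

theorem conformalForm_parallelogram (ℓ : Lengths) (x y : Fin 4 → ℝ) :
    conformalForm ℓ (x + y) + conformalForm ℓ (x - y) =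
      2 * conformalForm ℓ x + 2 * conformalForm ℓ y := by
  simp [conformalForm]
  ring

/-- The hypothesis says that the cross term vanishes; it will come from symmetries that fix one
vector and negate the other. -/
theorem conformalForm_add_of_eq {ℓ : Lengths} {x y : Fin 4 → ℝ}
    (h : conformalForm ℓ (x + y) = conformalForm ℓ (x - y)) :
    conformalForm ℓ (x + y) = conformalForm ℓ x + conformalForm ℓ y := by
  linarith [conformalForm_parallelogram ℓ x y]

theorem eventually_smul {E : Type*} [NormedAddCommGroup E] [NormedSpace ℝ E] {p : E → Prop}
    (h : ∀ᶠ f in 𝓝 0, p f) (x : E) : ∀ᶠ s : ℝ in 𝓝 0, p (s • x) := by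
  have ht : Tendsto (fun s : ℝ => s • x) (𝓝 0) (𝓝 0) := by
    have : Continuous fun s : ℝ => s • x := by fun_prop
    simpa using this.tendsto 0
  exact ht.eventually h

theorem conformalChange_relabel (σ : Equiv.Perm (Fin 4)) (ℓ : Lengths) (f : Fin 4 → ℝ) :
    conformalChange (relabel σ ℓ) (f ∘ σ) = relabel σ (conformalChange ℓ f) := rfl

theorem Nondegenerate.conformalForm_relabel {ℓ : Lengths} (h : Nondegenerate ℓ)
    (σ : Equiv.Perm (Fin 4)) (x : Fin 4 → ℝ) :
    conformalForm (DoubleTetrahedron.relabel σ ℓ) (x ∘ σ) = conformalForm ℓ x := by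
  refine (h.relabel σ).conformalForm_congr h ?_
  filter_upwards [eventually_smul h.eventually_conformalChange x] with s hs
  rw [conformalLEHR, conformalLEHR, ← hs.LEHR_relabel σ, ← conformalChange_relabel]
  rfl

theorem dihedralAngle_smul {ℓ : Lengths} {r : ℝ} (hr : r ≠ 0) (i j k l : Fin 4) :
    dihedralAngle (fun i j => r * ℓ i j) i j k l = dihedralAngle ℓ i j k l := by
  have e : ∀ i j k, faceAngle (fun i j => r * ℓ i j) i j k = faceAngle ℓ i j k := by
    intro i j k
    rw [faceAngle, faceAngle]
    congr 1
    rw [show (r * ℓ i j) ^ 2 + (r * ℓ i k) ^ 2 - (r * ℓ j k) ^ 2 =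
      r ^ 2 * (ℓ i j ^ 2 + ℓ i k ^ 2 - ℓ j k ^ 2) by ring,
      show 2 * (r * ℓ i j) * (r * ℓ i k) = r ^ 2 * (2 * ℓ i j * ℓ i k) by ring]
    exact mul_div_mul_left _ _ (by positivity)
  simp only [dihedralAngle, e]

theorem LEHR_smul (ℓ : Lengths) {r : ℝ} (hr : r ≠ 0) :
    LEHR (fun i j => r * ℓ i j) = LEHR ℓ := by
  rw [LEHR_eq, LEHR_eq]
  simp only [dihedralAngle_smul hr, mul_left_comm _ r, ← mul_add]
  exact mul_div_mul_left _ _ hr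

/-- A constant conformal factor rescales all lengths at once, and `LEHR` is scale invariant. -/
theorem Nondegenerate.conformalForm_add_const {ℓ : Lengths} (h : Nondegenerate ℓ)
    (x : Fin 4 → ℝ) (m : ℝ) : conformalForm ℓ (x + fun _ => m) = conformalForm ℓ x := by
  refine h.conformalForm_congr h (Eventually.of_forall fun s => ?_)
  rw [conformalLEHR, conformalLEHR,
    ← LEHR_smul (conformalChange ℓ (s • x)) (Real.exp_ne_zero (s * m))]
  congr 1
  funext i j
  simp only [conformalChange, ← mul_assoc, ← Real.exp_add, Pi.smul_apply, Pi.add_apply,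
    smul_eq_mul]
  congr 2
  ring

/-- The quadratic form of a metric with the symmetries of `disphenoid a b b` is diagonal. -/
theorem conformalForm_disphenoid {a b : ℝ} (h : Nondegenerate (disphenoid a b b))
    (x : Fin 4 → ℝ) : conformalForm (disphenoid a b b) x =
      ((x 0 + x 1 - x 2 - x 3) / 4) ^ 2 * conformalForm (disphenoid a b b) ![1, 1, -1, -1] +
      (((x 0 - x 1) / 2) ^ 2 + ((x 2 - x 3) / 2) ^ 2) / 2 *
        conformalForm (disphenoid a b b) ![1, -1, 1, -1] := by
  have sym : ∀ σ ∈ [Equiv.swap (0 : Fin 4) 1, Equiv.swap 2 3, Equiv.swap 0 2 * Equiv.swap 1 3],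
      ∀ x, conformalForm (disphenoid a b b) (x ∘ σ) = conformalForm (disphenoid a b b) x := by
    intro σ hσ x
    have e : relabel σ (disphenoid a b b) = disphenoid a b b := by
      simp only [List.mem_cons, List.not_mem_nil, or_false] at hσ
      rcases hσ with rfl | rfl | rfl <;> funext i j <;> fin_cases i <;> fin_cases j <;> rfl
    rw [← h.conformalForm_relabel σ x, e]
  have s1 := sym (Equiv.swap 0 1) (by simp)
  have s2 := sym (Equiv.swap 2 3) (by simp)
  have s3 := sym (Equiv.swap 0 2 * Equiv.swap 1 3) (by simp)
  -- The swap of 2 and 3 negates the last vector and fixes the middle one; the swap of 0 and 1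
  -- negates the first and fixes the other two. All cross terms vanish.
  have split : ∀ r u v : ℝ, conformalForm (disphenoid a b b)
      (u • ![1, -1, 0, 0] + (r • ![1, 1, -1, -1] + v • ![0, 0, 1, -1])) =
      u ^ 2 * conformalForm (disphenoid a b b) ![1, -1, 0, 0] +
      (r ^ 2 * conformalForm (disphenoid a b b) ![1, 1, -1, -1] +
        v ^ 2 * conformalForm (disphenoid a b b) ![0, 0, 1, -1]) := by
    intro r u v
    rw [← conformalForm_smul, ← conformalForm_smul, ← conformalForm_smul,
      conformalForm_add_of_eq (x := u • ![1, -1, 0, 0]),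
      conformalForm_add_of_eq (x := r • ![1, 1, -1, -1])]
    · rw [← s2]
      congr 1
      funext i
      fin_cases i <;> simp [Equiv.swap_apply_def, sub_eq_add_neg]
    · rw [← s1, ← conformalForm_neg]
      congr 1
      funext i
      fin_cases i <;> simp [sub_eq_add_neg] <;> ring
  have h3 : conformalForm (disphenoid a b b) ![0, 0, 1, -1] =
      conformalForm (disphenoid a b b) ![1, -1, 0, 0] := by
    rw [← s3]
    congr 1
    funext i
    fin_cases i <;> rfl
  have h2 : conformalForm (disphenoid a b b) ![1, -1, 1, -1] =
      2 * conformalForm (disphenoid a b b) ![1, -1, 0, 0] := by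
    have := split 0 1 1
    rw [h3] at this
    rw [show (![1, -1, 1, -1] : Fin 4 → ℝ) = (1 : ℝ) • ![1, -1, 0, 0] +
      ((0 : ℝ) • ![1, 1, -1, -1] + (1 : ℝ) • ![0, 0, 1, -1]) by
        funext i; fin_cases i <;> simp, this]
    ring
  have hx : x = ((x 0 - x 1) / 2) • ![1, -1, 0, 0] +
      (((x 0 + x 1 - x 2 - x 3) / 4) • ![1, 1, -1, -1] +
        ((x 2 - x 3) / 2) • ![0, 0, 1, -1]) + fun _ => (x 0 + x 1 + x 2 + x 3) / 4 := by
    funext i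
    fin_cases i <;> simp <;> ring
  conv_lhs => rw [hx]
  rw [h.conformalForm_add_const, split, h2, h3]
  ring

/-- Exchanging the labels 1 and 2 moves the direction `(1, -1, 1, -1)` to `(1, 1, -1, -1)`, so both
tests concern varying a single pair of opposite edges. -/
theorem conformallyConvexAt_disphenoid_iff {a b : ℝ} (h : Nondegenerate (disphenoid a b b)) :
    ConformallyConvexAt (disphenoid a b b) ↔
      0 ≤ conformalForm (disphenoid a b b) ![1, 1, -1, -1] ∧
      0 ≤ conformalForm (disphenoid b a b) ![1, 1, -1, -1] := by
  have e : conformalForm (disphenoid b a b) ![1, 1, -1, -1] =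
      conformalForm (disphenoid a b b) ![1, -1, 1, -1] := by
    rw [← h.conformalForm_relabel (Equiv.swap 1 2)]
    congr 1
    · funext i j
      fin_cases i <;> fin_cases j <;> rfl
    · funext i
      fin_cases i <;> rfl
  rw [h.conformallyConvexAt_iff, e]
  refine ⟨fun H => ⟨H _, H _⟩, fun H x => ?_⟩
  rw [conformalForm_disphenoid h]
  have := H.1
  have := H.2
  positivity

/-! ### The Schläfli formula and the second derivative -/

/-- Here `r` is the sine of the angle. Supplying it explicitly lets all dihedral derivatives share
one square root, the volume. -/
theorem HasDerivAt.arccos_of_sq_add_sq {g : ℝ → ℝ} {g' r s : ℝ} (hg : HasDerivAt g g' s)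
    (hr : 0 < r) (h : g s ^ 2 + r ^ 2 = 1) :
    HasDerivAt (fun s => Real.arccos (g s)) (-g' / r) s := by
  have hlt : g s ^ 2 < 1 := by nlinarith
  have hx := abs_lt.1 ((sq_lt_one_iff_abs_lt_one _).1 hlt)
  have := (Real.hasDerivAt_arccos hx.1.ne' hx.2.ne).comp s hg
  rw [show 1 - g s ^ 2 = r ^ 2 by linarith, Real.sqrt_sq hr.le] at this
  exact this.congr_deriv (by ring)

theorem hasDerivAt_arccos_one_sub_div {F : ℝ → ℝ} {F' K P V s : ℝ} (hF : HasDerivAt F F' s)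
    (hpos : 0 < F s) (hP : 0 < P) (hV : 0 < V)
    (h : K * (2 * F s - K) = 4 * P ^ 2 * V ^ 2) :
    HasDerivAt (fun s => Real.arccos (1 - K / F s)) (-(K * F') / (2 * P * V * F s)) s := by
  have hg : HasDerivAt (fun s => 1 - K / F s) (K * F' / F s ^ 2) s :=
    (((hasDerivAt_const s K).div hF hpos.ne').const_sub 1).congr_deriv (by ring)
  refine (HasDerivAt.arccos_of_sq_add_sq (r := 2 * P * V / F s) hg (by positivity) ?_).congr_deriv
    (by field_simp)
  field_simp
  linarith

theorem hasDerivAt_arccos_div_sqrt {M F F₂ : ℝ → ℝ} {M' F' F₂' b V s : ℝ}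
    (hM : HasDerivAt M M' s) (hF : HasDerivAt F F' s) (hF₂ : HasDerivAt F₂ F₂' s)
    (hpos : 0 < F s) (hpos₂ : 0 < F₂ s) (hb : 0 < b) (hV : 0 < V)
    (h : F s * F₂ s - M s ^ 2 = 4 * b ^ 2 * V ^ 2) :
    HasDerivAt (fun s => Real.arccos (M s / (√(F s) * √(F₂ s))))
      (-(M' - M s * (F' / F s + F₂' / F₂ s) / 2) / (2 * b * V)) s := by
  have hf := Real.sqrt_pos.2 hpos
  have hf₂ := Real.sqrt_pos.2 hpos₂
  have hg := hM.div ((hF.sqrt hpos.ne').mul (hF₂.sqrt hpos₂.ne'))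
    (mul_pos hf hf₂).ne'
  refine (HasDerivAt.arccos_of_sq_add_sq (r := 2 * b * V / (√(F s) * √(F₂ s))) hg
    (by positivity) ?_).congr_deriv ?_
  · simp only [Pi.div_apply, Pi.mul_apply, div_pow, mul_pow, Real.sq_sqrt hpos.le,
      Real.sq_sqrt hpos₂.le]
    field_simp
    linarith
  · have e1 := Real.sq_sqrt hpos.le
    have e2 := Real.sq_sqrt hpos₂.le
    simp only [Pi.mul_apply]
    generalize √(F s) = f at *
    generalize √(F₂ s) = f₂ at *
    rw [← e1, ← e2]
    field_simp

/-- The edge lengths obtained from a disphenoid by changing one pair of opposite edges. -/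
def pairTable (p q b c : ℝ) : Lengths :=
  ![![0, p, b, c], ![p, 0, c, b], ![b, c, 0, q], ![c, b, q, 0]]

/-- Sixteen times the squared area of the triangle with sides `p`, `b`, `c`. -/
def triangleAreaSq (b c p : ℝ) : ℝ := 2 * p ^ 2 * (b ^ 2 + c ^ 2) - p ^ 4 - (b ^ 2 - c ^ 2) ^ 2

/-- The numerator of the cosine of the dihedral angle at the edges of length `b` of
`pairTable p q b c`. -/
def sideNum (p q b c : ℝ) : ℝ :=
  (b ^ 2 - c ^ 2) * (p ^ 2 + q ^ 2) + (p * q) ^ 2 + (c ^ 2 - b ^ 2) * (c ^ 2 + 3 * b ^ 2)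

/-- The sum of the dihedral angles of `pairTable p q b c`, weighted by the edge lengths. -/
noncomputable def angleSum (p q b c : ℝ) : ℝ :=
  p * Real.arccos (1 - 2 * ((p * q) ^ 2 - (b ^ 2 - c ^ 2) ^ 2) / triangleAreaSq b c p) +
  q * Real.arccos (1 - 2 * ((p * q) ^ 2 - (b ^ 2 - c ^ 2) ^ 2) / triangleAreaSq b c q) +
  2 * b * Real.arccos (sideNum p q b c / (√(triangleAreaSq b c p) * √(triangleAreaSq b c q))) +
  2 * c * Real.arccos (sideNum p q c b / (√(triangleAreaSq b c p) * √(triangleAreaSq b c q)))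

theorem Nondegenerate.triangleAreaSq_pos {p q b c : ℝ} (h : Nondegenerate (pairTable p q b c)) :
    0 < triangleAreaSq b c p ∧ 0 < triangleAreaSq b c q := by
  have h1 := h.face 0 1 2 (by decide) (by decide) (by decide)
  have h2 := h.face 2 3 0 (by decide) (by decide) (by decide)
  simp [sixteenAreaSq, pairTable] at h1 h2
  constructor <;> rw [triangleAreaSq] <;> linarith

/-- The `2π` terms contribute a constant, so only the length-weighted mean of the dihedral angles
varies. -/
theorem Nondegenerate.LEHR_pairTable {p q b c : ℝ} (h : Nondegenerate (pairTable p q b c)) :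
    LEHR (pairTable p q b c) =
      2 * Real.pi - 2 * (angleSum p q b c / (p + q + 2 * b + 2 * c)) := by
  obtain ⟨hp, hq⟩ := h.triangleAreaSq_pos
  have p1 : 0 < p := h.pos 0 1 (by decide)
  have p2 : 0 < q := h.pos 2 3 (by decide)
  have p3 : 0 < b := h.pos 0 2 (by decide)
  have p4 : 0 < c := h.pos 0 3 (by decide)
  have d1 : dihedralAngle (pairTable p q b c) 0 1 2 3 = Real.arccos
      (1 - 2 * ((p * q) ^ 2 - (b ^ 2 - c ^ 2) ^ 2) / triangleAreaSq b c p) := by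
    rw [h.dihedralAngle_eq (by decide) (by decide) (by decide) (by decide) (by decide) (by decide)]
    have e : sixteenAreaSq (pairTable p q b c) 0 1 2 = triangleAreaSq b c p := by
      simp [sixteenAreaSq, pairTable, triangleAreaSq]; ring
    have e' : sixteenAreaSq (pairTable p q b c) 0 1 3 = triangleAreaSq b c p := by
      simp [sixteenAreaSq, pairTable, triangleAreaSq]; ring
    rw [e, e', Real.mul_self_sqrt hp.le, one_sub_div hp.ne']
    congr 2
    simp [dihedralNum, pairTable, triangleAreaSq]
    ring
  have d6 : dihedralAngle (pairTable p q b c) 2 3 0 1 = Real.arccos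
      (1 - 2 * ((p * q) ^ 2 - (b ^ 2 - c ^ 2) ^ 2) / triangleAreaSq b c q) := by
    rw [h.dihedralAngle_eq (by decide) (by decide) (by decide) (by decide) (by decide) (by decide)]
    have e : sixteenAreaSq (pairTable p q b c) 2 3 0 = triangleAreaSq b c q := by
      simp [sixteenAreaSq, pairTable, triangleAreaSq]; ring
    have e' : sixteenAreaSq (pairTable p q b c) 2 3 1 = triangleAreaSq b c q := by
      simp [sixteenAreaSq, pairTable, triangleAreaSq]; ring
    rw [e, e', Real.mul_self_sqrt hq.le, one_sub_div hq.ne']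
    congr 2
    simp [dihedralNum, pairTable, triangleAreaSq]
    ring
  have d2 : dihedralAngle (pairTable p q b c) 0 2 1 3 = Real.arccos
      (sideNum p q b c / (√(triangleAreaSq b c p) * √(triangleAreaSq b c q))) := by
    rw [h.dihedralAngle_eq (by decide) (by decide) (by decide) (by decide) (by decide) (by decide)]
    congr 4 <;> simp [dihedralNum, sixteenAreaSq, pairTable, triangleAreaSq, sideNum] <;> ring
  have d5 : dihedralAngle (pairTable p q b c) 1 3 0 2 = Real.arccos
      (sideNum p q b c / (√(triangleAreaSq b c p) * √(triangleAreaSq b c q))) := by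
    rw [h.dihedralAngle_eq (by decide) (by decide) (by decide) (by decide) (by decide) (by decide)]
    congr 4 <;> simp [dihedralNum, sixteenAreaSq, pairTable, triangleAreaSq, sideNum] <;> ring
  have d3 : dihedralAngle (pairTable p q b c) 0 3 1 2 = Real.arccos
      (sideNum p q c b / (√(triangleAreaSq b c p) * √(triangleAreaSq b c q))) := by
    rw [h.dihedralAngle_eq (by decide) (by decide) (by decide) (by decide) (by decide) (by decide)]
    congr 4 <;> simp [dihedralNum, sixteenAreaSq, pairTable, triangleAreaSq, sideNum] <;> ring
  have d4 : dihedralAngle (pairTable p q b c) 1 2 0 3 = Real.arccos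
      (sideNum p q c b / (√(triangleAreaSq b c p) * √(triangleAreaSq b c q))) := by
    rw [h.dihedralAngle_eq (by decide) (by decide) (by decide) (by decide) (by decide) (by decide)]
    congr 4 <;> simp [dihedralNum, sixteenAreaSq, pairTable, triangleAreaSq, sideNum] <;> ring
  rw [LEHR_eq, d1, d2, d3, d4, d5, d6, angleSum]
  simp only [show pairTable p q b c 0 1 = p from rfl, show pairTable p q b c 0 2 = b from rfl,
    show pairTable p q b c 0 3 = c from rfl, show pairTable p q b c 1 2 = c from rfl,
    show pairTable p q b c 1 3 = b from rfl, show pairTable p q b c 2 3 = q from rfl]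
  have : p + q + 2 * b + 2 * c ≠ 0 := by positivity
  rw [show p + b + c + c + b + q = p + q + 2 * b + 2 * c by ring]
  field_simp
  ring

theorem disphenoid_apply (a b c : ℝ) : disphenoid a b c =
    ![![0, a, b, c], ![a, 0, c, b], ![b, c, 0, a], ![c, b, a, 0]] := by
  funext i j
  fin_cases i <;> fin_cases j <;> rfl

theorem conformalChange_disphenoid (a b c s : ℝ) :
    conformalChange (disphenoid a b c) (s • ![1, 1, -1, -1]) =
      pairTable (Real.exp s * a) (Real.exp (-s) * a) b c := by
  have h1 : (s + s) / 2 = s := by ring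
  have h2 : (-s + -s) / 2 = -s := by ring
  funext i j
  fin_cases i <;> fin_cases j <;>
    simp [conformalChange, pairTable, disphenoid_apply, h1, h2]

theorem hasDerivAt_triangleAreaSq (b c : ℝ) {p : ℝ → ℝ} {p' s : ℝ} (hp : HasDerivAt p p' s) :
    HasDerivAt (fun s => triangleAreaSq b c (p s))
      (4 * p s * p' * (b ^ 2 + c ^ 2 - p s ^ 2)) s := by
  unfold triangleAreaSq
  exact (((((hp.pow 2).const_mul 2).mul_const (b ^ 2 + c ^ 2)).sub (hp.pow 4)).sub_const
    _).congr_deriv (by norm_num; ring)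

/-- The Schläfli formula for a disphenoid in which one pair of opposite edges is varied with
constant product. -/
theorem hasDerivAt_angleSum {p q : ℝ → ℝ} {b c s m : ℝ} (hp : HasDerivAt p (p s) s)
    (hq : HasDerivAt q (-q s) s) (hpq : ∀ s, p s * q s = m)
    (hK : 0 < m ^ 2 - (b ^ 2 - c ^ 2) ^ 2) (h : Nondegenerate (pairTable (p s) (q s) b c)) :
    HasDerivAt (fun s => angleSum (p s) (q s) b c)
      (p s * Real.arccos (1 - 2 * (m ^ 2 - (b ^ 2 - c ^ 2) ^ 2) / triangleAreaSq b c (p s)) -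
        q s * Real.arccos (1 - 2 * (m ^ 2 - (b ^ 2 - c ^ 2) ^ 2) / triangleAreaSq b c (q s)))
      s := by
  obtain ⟨hFp, hFq⟩ := h.triangleAreaSq_pos
  have p1 : 0 < p s := h.pos 0 1 (by decide)
  have p2 : 0 < q s := h.pos 2 3 (by decide)
  have p3 : 0 < b := h.pos 0 2 (by decide)
  have p4 : 0 < c := h.pos 0 3 (by decide)
  -- At the edge `01` the strict bound on the cosine of the dihedral angle factors as in `e`.
  have hS : 0 < 2 * (b ^ 2 + c ^ 2) - p s ^ 2 - q s ^ 2 := by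
    have hd := h.dihedral 0 1 2 3 (by decide) (by decide) (by decide) (by decide) (by decide)
      (by decide)
    have e : 0 < 4 * p s ^ 2 * (m ^ 2 - (b ^ 2 - c ^ 2) ^ 2) *
        (2 * (b ^ 2 + c ^ 2) - p s ^ 2 - q s ^ 2) := by
      simp [dihedralNum, sixteenAreaSq, pairTable] at hd
      rw [← hpq s]
      linarith
    exact pos_of_mul_pos_right e (by positivity)
  set κ := m ^ 2 - (b ^ 2 - c ^ 2) ^ 2 with hκ
  -- `V` is twelve times the volume, so each dihedral sine is `2 * V` times the edge length over the
  -- product of the two area roots.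
  set V := √(κ * (2 * (b ^ 2 + c ^ 2) - p s ^ 2 - q s ^ 2)) with hVdef
  have hV : 0 < V := Real.sqrt_pos.2 (by positivity)
  have hV2 : V ^ 2 = κ * (2 * (b ^ 2 + c ^ 2) - p s ^ 2 - q s ^ 2) := Real.sq_sqrt (by positivity)
  have dFp := hasDerivAt_triangleAreaSq b c hp
  have dFq := hasDerivAt_triangleAreaSq b c hq
  have dα := hasDerivAt_arccos_one_sub_div (K := 2 * κ) dFp hFp p1 hV (by
    rw [hV2, hκ, ← hpq s, triangleAreaSq]; ring)
  have dα' := hasDerivAt_arccos_one_sub_div (K := 2 * κ) dFq hFq p2 hV (by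
    rw [hV2, hκ, ← hpq s, triangleAreaSq]; ring)
  have dM : ∀ b c : ℝ, HasDerivAt (fun s => sideNum (p s) (q s) b c)
      ((b ^ 2 - c ^ 2) * (2 * p s * p s - 2 * q s * q s)) s := by
    intro b c
    simp only [sideNum, hpq]
    exact (((((hp.pow 2).add (hq.pow 2)).const_mul _).add_const _).add_const _).congr_deriv
      (by simp only [Nat.cast_ofNat, Nat.reduceSub, pow_one]; ring)
  have dβ := hasDerivAt_arccos_div_sqrt (dM b c) dFp dFq hFp hFq p3 hV (by
    rw [hV2, hκ, ← hpq s, triangleAreaSq, triangleAreaSq, sideNum]; ring)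
  have dγ := hasDerivAt_arccos_div_sqrt (dM c b) dFp dFq hFp hFq p4 hV (by
    rw [hV2, hκ, ← hpq s, triangleAreaSq, triangleAreaSq, sideNum]; ring)
  have main := (((hp.mul dα).add (hq.mul dα')).add (dβ.const_mul (2 * b))).add
    (dγ.const_mul (2 * c))
  simp only [angleSum, hpq]
  refine main.congr_deriv ?_
  -- The derivatives of the two side numerators are opposite and the numerators add up to `2 * κ`;
  -- this cancels all terms containing derivatives of angles.
  have hsum : sideNum (p s) (q s) b c + sideNum (p s) (q s) c b = 2 * κ := by
    rw [hκ, ← hpq s, sideNum, sideNum]; ring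
  have hMc : sideNum (p s) (q s) c b = 2 * κ - sideNum (p s) (q s) b c := by linarith
  rw [hMc]
  generalize sideNum (p s) (q s) b c = M
  generalize Real.arccos _ = A₁
  generalize Real.arccos _ = A₂
  field_simp
  ring

/-- The second derivative of `LEHR` at a disphenoid in the conformal direction that changes only
one pair of opposite edges. -/
theorem IsAcute.conformalForm_eq {a b c : ℝ} (h : IsAcute a b c) :
    conformalForm (disphenoid a b c) ![1, 1, -1, -1] =
      -(4 * a * ((Real.arccos (1 - 2 * (a ^ 4 - (b ^ 2 - c ^ 2) ^ 2) / triangleAreaSq b c a) -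
        2 * a * √(2 * (a ^ 4 - (b ^ 2 - c ^ 2) ^ 2) * (b ^ 2 + c ^ 2 - a ^ 2)) /
          triangleAreaSq b c a) * (2 * (a + b + c)) - angleSum a a b c)) /
        (2 * (a + b + c)) ^ 2 := by
  have hn := h.nondegenerate
  obtain ⟨ha, hb, hc, h1, h2, h3⟩ := h
  have hκ : 0 < a ^ 4 - (b ^ 2 - c ^ 2) ^ 2 := by nlinarith [mul_pos h2 h3]
  have hF : 0 < triangleAreaSq b c a := by
    have := hn.face 0 1 2 (by decide) (by decide) (by decide)
    rw [triangleAreaSq]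
    simp [sixteenAreaSq, disphenoid_apply] at this
    linarith
  set p : ℝ → ℝ := fun s => Real.exp s * a with hpdef
  set q : ℝ → ℝ := fun s => Real.exp (-s) * a with hqdef
  have hp : ∀ s, HasDerivAt p (p s) s := fun s => (Real.hasDerivAt_exp s).mul_const a
  have hq : ∀ s, HasDerivAt q (-q s) s := fun s =>
    ((hasDerivAt_neg s).exp.mul_const a).congr_deriv (by simp [hqdef])
  have hpq : ∀ s, p s * q s = a ^ 2 := fun s => by
    simp only [hpdef, hqdef]
    rw [mul_mul_mul_comm, ← Real.exp_add]
    simp [sq]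
  have p0 : p 0 = a := by simp [hpdef]
  have q0 : q 0 = a := by simp [hqdef]
  set κ := a ^ 4 - (b ^ 2 - c ^ 2) ^ 2 with hκdef
  have hκ' : (a ^ 2) ^ 2 - (b ^ 2 - c ^ 2) ^ 2 = κ := by rw [hκdef]; ring
  set α : ℝ → ℝ := fun s => Real.arccos (1 - 2 * κ / triangleAreaSq b c (p s)) with hα
  set α' : ℝ → ℝ := fun s => Real.arccos (1 - 2 * κ / triangleAreaSq b c (q s)) with hα'
  set D : ℝ → ℝ := fun s => p s + q s + 2 * b + 2 * c with hD
  set N : ℝ → ℝ := fun s => angleSum (p s) (q s) b c with hN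
  have hDs : ∀ s, HasDerivAt D (p s - q s) s := fun s =>
    ((((hp s).add (hq s)).add_const _).add_const _).congr_deriv (by ring)
  have hDpos : ∀ s, 0 < D s := fun s => by simp only [hD, hpdef, hqdef]; positivity
  have hev : ∀ᶠ s in 𝓝 (0 : ℝ), Nondegenerate (pairTable (p s) (q s) b c) := by
    filter_upwards [eventually_smul hn.eventually_conformalChange ![1, 1, -1, -1]] with s hs
    rwa [conformalChange_disphenoid] at hs
  have hNs : ∀ᶠ s in 𝓝 (0 : ℝ), HasDerivAt N (p s * α s - q s * α' s) s := by
    filter_upwards [hev] with s hs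
    have := hasDerivAt_angleSum (hp s) (hq s) hpq (by rw [hκ']; exact hκ) hs
    rwa [hκ'] at this
  set R : ℝ → ℝ := fun s => (p s * α s - q s * α' s) * D s - N s * (p s - q s) with hR
  have hL : (fun s : ℝ => conformalLEHR (disphenoid a b c) (s • ![1, 1, -1, -1])) =ᶠ[𝓝 0]
      fun s => 2 * Real.pi - 2 * (N s / D s) := by
    filter_upwards [hev] with s hs
    rw [conformalLEHR, conformalChange_disphenoid]
    exact hs.LEHR_pairTable
  have hL' : (deriv fun s : ℝ => conformalLEHR (disphenoid a b c) (s • ![1, 1, -1, -1])) =ᶠ[𝓝 0]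
      fun s => -2 * (R s / D s ^ 2) := by
    refine hL.deriv.trans ?_
    filter_upwards [hNs] with s hs
    exact ((((hs.div (hDs s) (hDpos s).ne').const_mul 2).const_sub _).congr_deriv
      (by simp only [hR]; ring)).deriv
  rw [hn.conformalForm_eq, hL'.deriv_eq]
  set w := b ^ 2 + c ^ 2 - a ^ 2 with hw
  set V := √(2 * κ * w) with hVdef
  have hV : 0 < V := Real.sqrt_pos.2 (by positivity)
  have hV2 : V ^ 2 = 2 * κ * w := Real.sq_sqrt (by positivity)
  have dα : HasDerivAt α (-(2 * a * V) / triangleAreaSq b c a) 0 := by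
    have dF := hasDerivAt_triangleAreaSq b c (hp 0)
    refine (hasDerivAt_arccos_one_sub_div (K := 2 * κ) (P := a) (V := V) dF (by rwa [p0]) ha hV
      (by rw [hV2, hκdef, hw, p0, triangleAreaSq]; ring)).congr_deriv ?_
    rw [p0, ← hw]
    field_simp
    linarith
  have dα' : HasDerivAt α' (2 * a * V / triangleAreaSq b c a) 0 := by
    have dF := hasDerivAt_triangleAreaSq b c (hq 0)
    refine (hasDerivAt_arccos_one_sub_div (K := 2 * κ) (P := a) (V := V) dF (by rwa [q0]) ha hV
      (by rw [hV2, hκdef, hw, q0, triangleAreaSq]; ring)).congr_deriv ?_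
    rw [q0, ← hw]
    field_simp
    linarith
  have dR : HasDerivAt R _ 0 := ((((hp 0).mul dα).sub ((hq 0).mul dα')).mul (hDs 0)).sub
    (hNs.self_of_nhds.mul ((hp 0).sub (hq 0)))
  have hα0 : α' 0 = α 0 := by simp only [hα, hα', p0, q0]
  -- By symmetry `0` is critical, so differentiating the denominator `D ^ 2` contributes nothing.
  have hR0 : R 0 = 0 := by simp only [hR, p0, q0, hα0]; ring
  have hfin := (dR.div ((hDs 0).pow 2) (pow_ne_zero 2 (hDpos 0).ne')).const_mul (-2)
  refine hfin.deriv.trans ?_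
  have hD0 : D 0 = 2 * (a + b + c) := by simp only [hD, p0, q0]; ring
  have hN0 : N 0 = angleSum a a b c := by simp only [hN, p0, q0]
  have hαeq : α 0 = Real.arccos (1 - 2 * κ / triangleAreaSq b c a) := by simp only [hα, p0]
  simp only [hR0, Pi.mul_apply, Pi.sub_apply, Pi.pow_apply, hα0, p0, q0, hD0, hN0, ← hαeq]
  field_simp
  ring

/-! ### The one-parameter family and its threshold -/

theorem sq_lt_two_of_lt_sqrt_two {t : ℝ} (h1 : 1 ≤ t) (h2 : t < √2) : t ^ 2 < 2 :=
  (Real.lt_sqrt (by linarith)).1 h2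

theorem isAcute_family {t : ℝ} (h1 : 1 ≤ t) (h2 : t < √2) : IsAcute t 1 1 := by
  have := sq_lt_two_of_lt_sqrt_two h1 h2
  constructor <;> nlinarith

theorem equihedralMetric_family {t : ℝ} (h1 : 1 ≤ t) (h2 : t < √2) :
    EquihedralMetric (family t) := by
  have h := sq_lt_two_of_lt_sqrt_two h1 h2
  obtain ⟨T, hT⟩ := exists_realizes_disphenoid (a := t) (b := 1) (c := 1) (x := √(t ^ 2 / 2))
    (y := √(t ^ 2 / 2)) (z := √(1 - t ^ 2 / 2)) (Real.sqrt_pos.2 (by positivity))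
    (Real.sqrt_pos.2 (by positivity)) (Real.sqrt_pos.2 (by linarith)) (by linarith) zero_le_one
    zero_le_one (by rw [Real.sq_sqrt (by positivity)]; ring)
    (by rw [Real.sq_sqrt (by positivity), Real.sq_sqrt (by linarith)]; ring)
    (by rw [Real.sq_sqrt (by positivity), Real.sq_sqrt (by linarith)]; ring)
  exact ⟨T, family_eq_disphenoid t ▸ hT, hT.equihedralTetrahedron⟩

/-- The difference of the two dihedral angles of `family t`, minus the bound it must obey for
conformal convexity. -/
noncomputable def convexityDefect (t : ℝ) : ℝ :=
  Real.arccos (t * (4 - 3 * t) / (2 - t) ^ 2) - t * √(4 - 2 * t ^ 2) / (2 - t)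

/-- The cosine subtraction formula applies because the difference lies in `[0, π]`. A single
arccosine is easier to differentiate and to estimate numerically. -/
theorem arccos_sub_arccos {t : ℝ} (h1 : 1 ≤ t) (h2 : t < √2) :
    Real.arccos ((4 - 3 * t ^ 2) / (4 - t ^ 2)) - Real.arccos (t ^ 2 / (4 - t ^ 2)) =
      Real.arccos (t * (4 - 3 * t) / (2 - t) ^ 2) := by
  have h := sq_lt_two_of_lt_sqrt_two h1 h2
  have ht : t < 2 := by nlinarith
  have hd : 0 < 4 - t ^ 2 := by linarith
  have hle : (4 - 3 * t ^ 2) / (4 - t ^ 2) ≤ t ^ 2 / (4 - t ^ 2) := by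
    gcongr; nlinarith
  have b1 : -1 ≤ (4 - 3 * t ^ 2) / (4 - t ^ 2) := by rw [le_div_iff₀ hd]; linarith
  have b2 : t ^ 2 / (4 - t ^ 2) ≤ 1 := by rw [div_le_one hd]; linarith
  rw [← Real.arccos_cos (x := Real.arccos ((4 - 3 * t ^ 2) / (4 - t ^ 2)) -
    Real.arccos (t ^ 2 / (4 - t ^ 2))) (sub_nonneg.2 (Real.arccos_le_arccos hle))
    (by linarith [Real.arccos_le_pi ((4 - 3 * t ^ 2) / (4 - t ^ 2)),
      Real.arccos_nonneg (t ^ 2 / (4 - t ^ 2))]), Real.cos_sub,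
    Real.cos_arccos b1 (hle.trans b2), Real.cos_arccos (b1.trans hle) b2, Real.sin_arccos,
    Real.sin_arccos, ← Real.sqrt_mul' _ (by
      rw [sub_nonneg, sq_le_one_iff_abs_le_one, abs_le]; exact ⟨b1.trans hle, b2⟩)]
  congr 1
  have e : (1 - ((4 - 3 * t ^ 2) / (4 - t ^ 2)) ^ 2) * (1 - (t ^ 2 / (4 - t ^ 2)) ^ 2) =
      (8 * t * (2 - t ^ 2) / (4 - t ^ 2) ^ 2) ^ 2 := by
    field_simp
    ring
  have h3 : 2 - t ≠ 0 := by linarith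
  have h4 : 0 ≤ 2 - t ^ 2 := by linarith
  rw [e, Real.sqrt_sq (by positivity)]
  field_simp
  ring

theorem sqrt_sq_mul_mul {x : ℝ} (t : ℝ) (ht : 0 ≤ t) : √(t ^ 2 * x) = t * √x := by
  rw [Real.sqrt_mul (sq_nonneg t), Real.sqrt_sq ht]

theorem conformalForm_family_base {t : ℝ} (h1 : 1 ≤ t) (h2 : t < √2) :
    0 ≤ conformalForm (disphenoid t 1 1) ![1, 1, -1, -1] ↔ convexityDefect t ≤ 0 := by
  have h := sq_lt_two_of_lt_sqrt_two h1 h2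
  have hd : 0 < 4 - t ^ 2 := by linarith
  have hd2 : 0 < 2 - t := by nlinarith
  have hF : triangleAreaSq 1 1 t = t ^ 2 * (4 - t ^ 2) := by rw [triangleAreaSq]; ring
  have hF0 : 0 < triangleAreaSq 1 1 t := by rw [hF]; positivity
  have e1 : 1 - 2 * (t ^ 4 - (1 ^ 2 - 1 ^ 2) ^ 2) / triangleAreaSq 1 1 t =
      (4 - 3 * t ^ 2) / (4 - t ^ 2) := by
    rw [hF]; field_simp; ring
  have e1' : 1 - 2 * ((t * t) ^ 2 - (1 ^ 2 - 1 ^ 2) ^ 2) / triangleAreaSq 1 1 t =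
      (4 - 3 * t ^ 2) / (4 - t ^ 2) := by
    rw [hF]; field_simp; ring
  have e2 : sideNum t t 1 1 / triangleAreaSq 1 1 t = t ^ 2 / (4 - t ^ 2) := by
    rw [hF, sideNum]; field_simp; ring
  have e3 : √(2 * (t ^ 4 - (1 ^ 2 - 1 ^ 2) ^ 2) * (1 ^ 2 + 1 ^ 2 - t ^ 2)) =
      t ^ 2 * √(4 - 2 * t ^ 2) := by
    rw [← sqrt_sq_mul_mul _ (by positivity)]; congr 1; ring
  rw [(isAcute_family h1 h2).conformalForm_eq, angleSum, Real.mul_self_sqrt hF0.le, e1, e1', e2,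
    e3, convexityDefect, ← arccos_sub_arccos h1 h2, hF]
  generalize Real.arccos _ = B
  generalize Real.arccos _ = C
  generalize √(4 - 2 * t ^ 2) = W
  have e4 : -(4 * t * ((B - 2 * t * (t ^ 2 * W) / (t ^ 2 * (4 - t ^ 2))) * (2 * (t + 1 + 1)) -
      (t * B + t * B + 2 * 1 * C + 2 * 1 * C))) / (2 * (t + 1 + 1)) ^ 2 =
      (4 * t / (t + 2) ^ 2) * -(B - C - t * W / (2 - t)) := by
    rw [show (4 - t ^ 2 : ℝ) = (2 - t) * (t + 2) by ring]
    field_simp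
    ring
  rw [e4, mul_nonneg_iff_of_pos_left (by positivity), neg_nonneg]

/-- The angle `C` at the edges of length 1 is at most the angle `B` at those of length `t`. Both `2
* t * (C - B)` and the area term then enter with the favourable sign. -/
theorem conformalForm_family_side {t : ℝ} (h1 : 1 ≤ t) (h2 : t < √2) :
    0 ≤ conformalForm (disphenoid 1 t 1) ![1, 1, -1, -1] := by
  have h := sq_lt_two_of_lt_sqrt_two h1 h2
  have hd : 0 < 4 - t ^ 2 := by linarith
  have hF : triangleAreaSq t 1 1 = t ^ 2 * (4 - t ^ 2) := by rw [triangleAreaSq]; ring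
  have hF0 : 0 < triangleAreaSq t 1 1 := by rw [hF]; positivity
  have hA : IsAcute 1 t 1 := by
    constructor <;> nlinarith
  have e1 : 1 - 2 * (1 ^ 4 - (t ^ 2 - 1 ^ 2) ^ 2) / triangleAreaSq t 1 1 =
      t ^ 2 / (4 - t ^ 2) := by
    rw [hF]; field_simp; ring
  have e1' : 1 - 2 * ((1 * 1) ^ 2 - (t ^ 2 - 1 ^ 2) ^ 2) / triangleAreaSq t 1 1 =
      t ^ 2 / (4 - t ^ 2) := by
    rw [hF]; field_simp; ring
  have e2 : sideNum 1 1 t 1 / triangleAreaSq t 1 1 = (4 - 3 * t ^ 2) / (4 - t ^ 2) := by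
    rw [hF, sideNum]; field_simp; ring
  have e3 : sideNum 1 1 1 t / triangleAreaSq t 1 1 = t ^ 2 / (4 - t ^ 2) := by
    rw [hF, sideNum]; field_simp; ring
  have hle : Real.arccos (t ^ 2 / (4 - t ^ 2)) ≤
      Real.arccos ((4 - 3 * t ^ 2) / (4 - t ^ 2)) := by
    refine Real.arccos_le_arccos ?_
    gcongr; nlinarith
  rw [hA.conformalForm_eq, angleSum, Real.mul_self_sqrt hF0.le, e1, e1', e2, e3]
  generalize Real.arccos (t ^ 2 / (4 - t ^ 2)) = C at *
  generalize Real.arccos _ = B at *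
  have hX : 0 ≤ 2 * 1 * √(2 * (1 ^ 4 - (t ^ 2 - 1 ^ 2) ^ 2) * (t ^ 2 + 1 ^ 2 - 1 ^ 2)) /
      triangleAreaSq t 1 1 := div_nonneg (by positivity) hF0.le
  generalize 2 * 1 * √(2 * (1 ^ 4 - (t ^ 2 - 1 ^ 2) ^ 2) * (t ^ 2 + 1 ^ 2 - 1 ^ 2)) /
      triangleAreaSq t 1 1 = X at *
  refine div_nonneg ?_ (sq_nonneg _)
  have : 0 ≤ X * (2 * (1 + t + 1)) := by positivity
  nlinarith [mul_nonneg (by linarith : 0 ≤ t) (sub_nonneg.2 hle)]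

theorem conformallyConvexAt_family_iff {t : ℝ} (h1 : 1 ≤ t) (h2 : t < √2) :
    ConformallyConvexAt (family t) ↔ convexityDefect t ≤ 0 := by
  rw [family_eq_disphenoid, conformallyConvexAt_disphenoid_iff (isAcute_family h1 h2).nondegenerate,
    conformalForm_family_base h1 h2, and_iff_left (conformalForm_family_side h1 h2)]

/-- The endpoint `t = 1` is excluded because the argument of the arccosine is 1 there; monotonicity
up to it comes from continuity. -/
theorem hasDerivAt_convexityDefect {t : ℝ} (h1 : 1 < t) (h2 : t < √2) :
    HasDerivAt convexityDefect
      (2 * t * (4 * t - 2 - t ^ 2) / (√(4 - 2 * t ^ 2) * (2 - t) ^ 2)) t := by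
  have h := sq_lt_two_of_lt_sqrt_two h1.le h2
  have hd2 : 0 < 2 - t := by nlinarith
  have hpos : 0 < 4 - 2 * t ^ 2 := by linarith
  have hW := Real.sqrt_pos.2 hpos
  have hW2 := Real.sq_sqrt hpos.le
  have dx : HasDerivAt (fun t : ℝ => t * (4 - 3 * t) / (2 - t) ^ 2) (8 * (1 - t) / (2 - t) ^ 3)
      t := by
    refine (((hasDerivAt_id t).mul (((hasDerivAt_id t).const_mul 3).const_sub 4)).div
      (((hasDerivAt_id t).const_sub 2).pow 2) (pow_pos hd2 2).ne').congr_deriv ?_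
    simp
    field_simp
    ring
  have dw : HasDerivAt (fun t : ℝ => 4 - 2 * t ^ 2) (-4 * t) t :=
    (((hasDerivAt_pow 2 t).const_mul 2).const_sub 4).congr_deriv (by norm_num; ring)
  have d1 := HasDerivAt.arccos_of_sq_add_sq (r := 2 * (t - 1) * √(4 - 2 * t ^ 2) / (2 - t) ^ 2) dx
    (by have : 0 < t - 1 := by linarith
        positivity) (by
      rw [div_pow, div_pow, mul_pow (2 * (t - 1)), hW2]
      field_simp
      ring)
  have d2 := ((hasDerivAt_id t).mul (dw.sqrt hpos.ne')).div ((hasDerivAt_id t).const_sub 2)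
    hd2.ne'
  refine (d1.sub d2).congr_deriv ?_
  have ht : t - 1 ≠ 0 := by linarith
  simp only [id, Pi.mul_apply]
  rw [show 8 * (1 - t) / (2 - t) ^ 3 = -(8 * (t - 1) / (2 - t) ^ 3) by ring]
  generalize √(4 - 2 * t ^ 2) = W at *
  field_simp
  rw [hW2]
  ring

theorem continuousOn_convexityDefect : ContinuousOn convexityDefect (Set.Ico 1 (√2)) := by
  have hne : ∀ t ∈ Set.Ico (1 : ℝ) (√2), 2 - t ≠ 0 := fun t ht => by
    have := sq_lt_two_of_lt_sqrt_two ht.1 ht.2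
    have := ht.1
    intro h
    nlinarith
  refine ContinuousOn.sub (Real.continuous_arccos.comp_continuousOn (ContinuousOn.div
    (by fun_prop) (by fun_prop) fun t ht => pow_ne_zero 2 (hne t ht)))
    (ContinuousOn.div (by fun_prop) (by fun_prop) hne)

theorem strictMonoOn_convexityDefect : StrictMonoOn convexityDefect (Set.Ico 1 (√2)) := by
  refine strictMonoOn_of_deriv_pos (convex_Ico _ _) continuousOn_convexityDefect fun t ht => ?_
  rw [interior_Ico] at ht
  rw [(hasDerivAt_convexityDefect ht.1 ht.2).deriv]
  have h1 := ht.1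
  have h := sq_lt_two_of_lt_sqrt_two h1.le ht.2
  have hd2 : 0 < 2 - t := by nlinarith
  have hW : 0 < √(4 - 2 * t ^ 2) := Real.sqrt_pos.2 (by linarith)
  -- The roots are `2 - √2` and `2 + √2`, and they enclose the interval.
  have : 0 < 4 * t - 2 - t ^ 2 := by nlinarith
  positivity

theorem convexityDefect_neg : convexityDefect 1.31471 < 0 := by
  rw [convexityDefect, sub_neg]
  have hW : 0.736936 < √(4 - 2 * 1.31471 ^ 2) := by
    apply Real.lt_sqrt_of_sq_lt; norm_num
  -- The rational number `1.413791` separates the arccosine from the algebraic term. Its cosine is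
  -- the sine of about `0.157`, for which an upper Taylor bound suffices.
  have hR : 1.413791 < 1.31471 * √(4 - 2 * 1.31471 ^ 2) / (2 - 1.31471) := by
    rw [lt_div_iff₀ (by norm_num)]
    norm_num at hW ⊢
    linarith
  refine lt_trans ?_ hR
  have hπ := Real.pi_gt_d6
  have hπ' := Real.pi_lt_d6
  rw [← Real.arccos_cos (x := 1.413791) (by norm_num) (by linarith)]
  refine Real.arccos_lt_arccos (Real.neg_one_le_cos _) ?_ (by norm_num)
  rw [← Real.sin_pi_div_two_sub]
  have hl : 0.157005 ≤ Real.pi / 2 - 1.413791 := by linarith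
  have hu : Real.pi / 2 - 1.413791 ≤ 0.157006 := by linarith
  generalize Real.pi / 2 - 1.413791 = y at *
  have hy : |y| = y := abs_of_nonneg (by linarith)
  have hs := (abs_le.1 (Real.sin_bound (x := y) (by rw [hy]; linarith))).2
  rw [hy] at hs
  have h3 : (0.157005 : ℝ) ^ 3 ≤ y ^ 3 := by gcongr
  have h5 : y ^ 5 ≤ (0.157006 : ℝ) ^ 5 := by gcongr
  norm_num at h3 h5 hu hl ⊢
  linarith

theorem convexityDefect_pos : 0 < convexityDefect 1.31472 := by
  rw [convexityDefect, sub_pos]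
  have hW : √(4 - 2 * 1.31472 ^ 2) < 0.736901 := by
    rw [Real.sqrt_lt' (by norm_num)]; norm_num
  -- The separating rational is now `1.413756`, and a cubic lower bound for the sine suffices.
  have hR : 1.31472 * √(4 - 2 * 1.31472 ^ 2) / (2 - 1.31472) < 1.413756 := by
    rw [div_lt_iff₀ (by norm_num)]
    norm_num at hW ⊢
    linarith
  refine hR.trans ?_
  have hπ := Real.pi_gt_d6
  have hπ' := Real.pi_lt_d6
  rw [← Real.arccos_cos (x := 1.413756) (by norm_num) (by linarith)]
  refine Real.arccos_lt_arccos (by norm_num) ?_ (Real.cos_le_one _)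
  rw [← Real.sin_pi_div_two_sub]
  have hl : 0.157039 ≤ Real.pi / 2 - 1.413756 := by linarith
  have hu : Real.pi / 2 - 1.413756 ≤ 0.157041 := by linarith
  generalize Real.pi / 2 - 1.413756 = y at *
  have hs := Real.sin_gt_sub_cube (x := y) (by linarith)
  have h3 : y ^ 3 ≤ (0.157041 : ℝ) ^ 3 := by gcongr
  norm_num at h3 hu hl ⊢
  linarith

theorem lt_sqrt_two : (1.4 : ℝ) < √2 := by
  apply Real.lt_sqrt_of_sq_lt; norm_num

theorem exists_convexity_threshold : ∃ t₀ : ℝ, 1.31471 < t₀ ∧ t₀ < 1.31472 ∧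
    ∀ t : ℝ, 1 ≤ t → t < √2 →
      EquihedralMetric (family t) ∧ (ConformallyConvexAt (family t) ↔ t ≤ t₀) := by
  have hlt := lt_sqrt_two
  have hsub : Set.Icc (1.31471 : ℝ) 1.31472 ⊆ Set.Ico 1 (√2) := fun t ht =>
    ⟨by linarith [ht.1], by linarith [ht.2]⟩
  obtain ⟨t₀, ⟨h1, h2⟩, h0⟩ := intermediate_value_Ioo (by norm_num)
    (continuousOn_convexityDefect.mono hsub) ⟨convexityDefect_neg, convexityDefect_pos⟩
  refine ⟨t₀, h1, h2, fun t ht1 ht2 => ⟨equihedralMetric_family ht1 ht2, ?_⟩⟩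
  rw [conformallyConvexAt_family_iff ht1 ht2, ← h0]
  exact strictMonoOn_convexityDefect.le_iff_le ⟨ht1, ht2⟩ (hsub ⟨h1.le, h2.le⟩)

end DoubleTetrahedron

theorem theorem4p18 :
    -- at every equihedral metric, faces are acute, dual lengths are nonnegative,
    -- and the Laplacian is negative semidefinite
    (∀ ℓ : DoubleTetrahedron.Lengths, DoubleTetrahedron.EquihedralMetric ℓ →
      ∀ T : Fin 2 → DoubleTetrahedron.Tetrahedron,
        (∀ t, DoubleTetrahedron.Realizes (T t) ℓ) →
          (∀ (t : Fin 2) (a : Fin 4), ((T t).faceOpposite a).AcuteAngled) ∧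
          (∀ i j : Fin 4, i ≠ j → 0 ≤ DoubleTetrahedron.dualLength T i j) ∧
          (-DoubleTetrahedron.laplacian ℓ T).PosSemidef) ∧
    -- the Hessian is that of a twice continuously differentiable function
    (∀ ℓ : DoubleTetrahedron.Lengths, DoubleTetrahedron.EquihedralMetric ℓ →
      ContDiffAt ℝ 2 (DoubleTetrahedron.conformalLEHR ℓ) 0) ∧
    -- convexity holds at some, but not all, equihedral metrics
    (∃ ℓ : DoubleTetrahedron.Lengths, DoubleTetrahedron.EquihedralMetric ℓ ∧
      DoubleTetrahedron.ConformallyConvexAt ℓ) ∧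
    (∃ ℓ : DoubleTetrahedron.Lengths, DoubleTetrahedron.EquihedralMetric ℓ ∧
      ¬ DoubleTetrahedron.ConformallyConvexAt ℓ) ∧
    -- along the family `(t, 1, 1, 1, 1, t)` it is lost at `t₀ ≈ 1.3147`
    (∃ t₀ : ℝ, 1.31471 < t₀ ∧ t₀ < 1.31472 ∧
      ∀ t : ℝ, 1 ≤ t → t < √2 →
        DoubleTetrahedron.EquihedralMetric (DoubleTetrahedron.family t) ∧
        (DoubleTetrahedron.ConformallyConvexAt (DoubleTetrahedron.family t) ↔ t ≤ t₀)) := by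
  have hlt := DoubleTetrahedron.lt_sqrt_two
  obtain ⟨t₀, h1, h2, H⟩ := DoubleTetrahedron.exists_convexity_threshold
  refine ⟨fun ℓ hℓ T hT => ?_, fun ℓ hℓ => ?_, ?_, ?_, t₀, h1, h2, H⟩
  · obtain ⟨a, b, c, -, rfl⟩ := hℓ.exists_disphenoid
    exact ⟨fun t x => (hT t).faceOpposite_acuteAngled x,
      fun i j hij => DoubleTetrahedron.dualLength_nonneg hT hij,
      DoubleTetrahedron.posSemidef_neg_laplacian rfl hT⟩
  · obtain ⟨a, b, c, h, rfl⟩ := hℓ.exists_disphenoid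
    exact DoubleTetrahedron.contDiffAt_conformalLEHR h.nondegenerate
  -- The regular tetrahedron.
  · have h := H 1 le_rfl (by linarith)
    exact ⟨_, h.1, h.2.2 (by linarith)⟩
  -- The value `1.4` lies between the threshold and `√2`.
  · have h := H 1.4 (by norm_num) hlt
    exact ⟨_, h.1, fun hc => by linarith [h.2.1 hc]⟩
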